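/- Let $\mathbb{k}$ be an algebraically closed field of characteristic $0$, and let $\mathcal{C}$ be a $\mathbb{k}$-linear premodular category, i.e. a ribbon fusion category over $\mathbb{k}$: a semisimple $\mathbb{k}$-linear abelian rigid monoidal category with bilinear tensor product, finite-dimensional morphism spaces, finitely many isomorphism classes of simple objects and simple unit $\mathbf{1}$, equipped with a braiding $c_{A,B}: A\otimes B\to B\otimes A$ and a twist $\theta$, i.e. a natural automorphism of $\mathrm{id}_{\mathcal{C}}$ with $\theta_{X\otimes Y}=(\theta_X\otimes\theta_Y)\circ c_{Y,X}\circ c_{X,Y}$ and $(\theta_X)^*=\theta_{X^*}$. Assume that the dimension $\mathcal{D}=\sum_j d_j^2\in\mathrm{End}(\mathbf 1)$ of $\mathcal{C}$ is nonzero, where $j$ runs over the isomorphism classes of simple objects $X_j$ and $d_j=\dim X_j$ is the categorical dimension. A half-braiding on an object $X$ is a natural isomorphism $\lambda: -\otimes X\to X\otimes -$ with $\lambda_{A\otimes B}=(\lambda_A\otimes \mathrm{id}_B)\circ(\mathrm{id}_A\otimes\lambda_B)$ (associativity constraints suppressed). The elliptic Drinfeld center $\mathcal{Z}^{\mathrm{el}}(\mathcal{C})$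 is the category whose objects are the triples $(X,\lambda^1,\lambda^2)$, with $X\in\mathcal{C}$ and $\lambda^1,\lambda^2$ half-braidings on $X$ such that for all $A,B\in\mathcal{C}$ $$(\mathrm{id}_X\otimes c_{A,B})\circ(\lambda^1_A\otimes\mathrm{id}_B)\circ(\mathrm{id}_A\otimes\lambda^2_B)=(\lambda^2_B\otimes\mathrm{id}_A)\circ(\mathrm{id}_B\otimes\lambda^1_A)\circ(c_{B,A}^{-1}\otimes\mathrm{id}_X)$$ as morphisms $A\otimes B\otimes X\to X\otimes B\otimes A$. A morphism $(X,\lambda^1,\lambda^2)\to(Y,\mu^1,\mu^2)$ is a morphism $f:X\to Y$ of $\mathcal{C}$ with $\mu^i_A\circ(\mathrm{id}_A\otimes f)=(f\otimes\mathrm{id}_A)\circ\lambda^i_A$ for $i=1,2$ and all $A\in\mathcal{C}$; composition and addition of morphisms are those of $\mathcal{C}$. Then $\mathcal{Z}^{\mathrm{el}}(\mathcal{C})$ is abelian (with this addition of morphisms), it is semisimple (every object is a finite direct sum of simple objects), and it has finitely many simple objects up to isomorphism. -/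

import Mathlib

open CategoryTheory MonoidalCategory Limits

universe w v u

noncomputable section

/-! ## Semisimple categories with finitely many simple objects -/

/-- A preadditive category is semisimple if every object is a finite direct sum
(possibly empty) of simple objects. -/
def IsSemisimpleCategory (D : Type u) [Category.{v} D] [Preadditive D] : Prop :=
  ∀ X : D, ∃ (n : ℕ) (S : Fin n → D) (b : Bicone S),
    (∀ i, Simple (S i)) ∧ Nonempty b.IsBilimit ∧ Nonempty (b.pt ≅ X)

/-- The isomorphism classes of simple objects. -/
def SimpleClass (D : Type u) [Category.{v} D] [Preadditive D] : Type u :=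
  {q : Quotient (isIsomorphicSetoid D) // ∃ X : D, Simple X ∧ Quotient.mk _ X = q}

/-- A chosen representative `X_j` of an isomorphism class `j` of simple objects. -/
def SimpleClass.rep {D : Type u} [Category.{v} D] [Preadditive D] (j : SimpleClass D) : D :=
  Quotient.out j.1

/-- The chosen representative is indeed simple. -/
theorem SimpleClass.simple_rep {D : Type u} [Category.{v} D] [Preadditive D]
    (j : SimpleClass D) : Simple j.rep := by
  obtain ⟨q, X, hX, rfl⟩ := j
  have h : Nonempty (Quotient.out (Quotient.mk (isIsomorphicSetoid D) X) ≅ X) :=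
    Quotient.mk_out (s := isIsomorphicSetoid D) X
  exact Simple.of_iso h.some

/-! ## Premodular categories: ribbon fusion categories -/

/-- A `k`-linear fusion category: a semisimple `k`-linear abelian rigid monoidal category with
bilinear tensor product, finite-dimensional morphism spaces, finitely many isomorphism classes of
simple objects, and simple unit object. (That the category is abelian, linear, rigid and that its
tensor product is bilinear is expressed by the instance arguments.) -/
class IsFusionCategory (k : Type w) [Field k] (C : Type u) [Category.{v} C] [Abelian C]
    [Linear k C] [MonoidalCategory C] [MonoidalPreadditive C] [MonoidalLinear k C]
    [RigidCategory C] : Prop where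
  finiteDimensional_hom : ∀ X Y : C, FiniteDimensional k (X ⟶ Y)
  semisimple : IsSemisimpleCategory C
  finite_simples : Finite (SimpleClass C)
  simple_unit : Simple (𝟙_ C)

/-- A ribbon structure on a braided rigid monoidal category: a twist, that is, a natural
automorphism `θ` of the identity functor with
`θ_{X ⊗ Y} = (θ_X ⊗ θ_Y) ∘ c_{Y,X} ∘ c_{X,Y}`, which is self-dual: `(θ_X)^* = θ_{X^*}`. Here
`Xᘁ` is the dual `X^*`, with `ev : X^* ⊗ X ⟶ 𝟙` and `coev : 𝟙 ⟶ X ⊗ X^*`. -/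
class RibbonCategory (C : Type u) [Category.{v} C] [MonoidalCategory C] [BraidedCategory C]
    [RigidCategory C] where
  twist : ∀ X : C, X ≅ X
  twist_naturality : ∀ {X Y : C} (f : X ⟶ Y), f ≫ (twist Y).hom = (twist X).hom ≫ f
  twist_tensor : ∀ X Y : C,
    (twist (X ⊗ Y)).hom =
      (β_ X Y).hom ≫ (β_ Y X).hom ≫ ((twist X).hom ⊗ₘ (twist Y).hom)
  twist_dual : ∀ X : C, rightAdjointMate (twist X).hom = (twist (Xᘁ)).hom

/-- The categorical (quantum) dimension
`dim X = ev_X ∘ c_{X,X^*} ∘ (θ_X ⊗ id) ∘ coev_X ∈ End(𝟙)`. -/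
def categoricalDim {C : Type u} [Category.{v} C] [MonoidalCategory C] [BraidedCategory C]
    [RigidCategory C] [RibbonCategory C] (X : C) : End (𝟙_ C) :=
  End.of (η_ X (Xᘁ) ≫ (RibbonCategory.twist X).hom ▷ (Xᘁ) ≫ (β_ X (Xᘁ)).hom ≫ ε_ X (Xᘁ))

/-- The dimension `∑_j d_j ^ 2 ∈ End(𝟙)` of the category, `d_j = dim X_j`, the sum being over
the isomorphism classes of simple objects. -/
def globalDim (C : Type u) [Category.{v} C] [Preadditive C] [MonoidalCategory C]
    [BraidedCategory C] [RigidCategory C] [RibbonCategory C] : End (𝟙_ C) :=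
  ∑ᶠ j : SimpleClass C, categoricalDim j.rep ^ 2

/-! ## Half-braidings

A half-braiding on `X` in Mathlib is a natural isomorphism `X ⊗ - ≅ - ⊗ X` that respects tensor
products. Its inverse is a natural isomorphism `- ⊗ X ≅ X ⊗ -` that respects tensor products, and
this is the form in which half-braidings `λ` are used below. -/

section HalfBraiding

variable {C : Type u} [Category.{v} C] [MonoidalCategory C]

/-- The half-braiding in the form `λ_A : A ⊗ X ≅ X ⊗ A`. -/
def CategoryTheory.HalfBraiding.lam {X : C} (b : HalfBraiding X) (A : C) : A ⊗ X ≅ X ⊗ A :=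
  (b.β A).symm

/-- `λ` is natural. -/
theorem CategoryTheory.HalfBraiding.lam_naturality {X : C} (b : HalfBraiding X) {A B : C}
    (f : A ⟶ B) : f ▷ X ≫ (b.lam B).hom = (b.lam A).hom ≫ X ◁ f := by
  simp [HalfBraiding.lam, ← cancel_mono (b.β B).hom]

/-- `λ` respects tensor products: `λ_{A ⊗ B} = (λ_A ⊗ id_B) ∘ (id_A ⊗ λ_B)`. -/
theorem CategoryTheory.HalfBraiding.lam_tensor {X : C} (b : HalfBraiding X) (A B : C) :
    (b.lam (A ⊗ B)).hom =
      (α_ A B X).hom ≫ A ◁ (b.lam B).hom ≫ (α_ A X B).inv ≫ (b.lam A).hom ▷ B ≫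
        (α_ X A B).hom := by
  simp only [HalfBraiding.lam, Iso.symm_hom]
  rw [← cancel_epi (b.β (A ⊗ B)).hom, Iso.hom_inv_id, b.monoidal]
  simp [← comp_whiskerRight_assoc, ← MonoidalCategory.whiskerLeft_comp_assoc]

/-- A family of isomorphisms `A ⊗ X ≅ X ⊗ A` that is natural and respects tensor products is a
half-braiding. -/
def CategoryTheory.HalfBraiding.ofLam {X : C} (l : ∀ A : C, A ⊗ X ≅ X ⊗ A)
    (naturality : ∀ {A B : C} (f : A ⟶ B), f ▷ X ≫ (l B).hom = (l A).hom ≫ X ◁ f)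
    (tensor : ∀ A B : C, (l (A ⊗ B)).hom =
      (α_ A B X).hom ≫ A ◁ (l B).hom ≫ (α_ A X B).inv ≫ (l A).hom ▷ B ≫ (α_ X A B).hom) :
    HalfBraiding X where
  β A := (l A).symm
  monoidal A B := by
    rw [Iso.symm_hom, ← cancel_epi (l (A ⊗ B)).hom, Iso.hom_inv_id, tensor]
    simp [← comp_whiskerRight_assoc, ← MonoidalCategory.whiskerLeft_comp_assoc]
  naturality {A B} f := by
    rw [Iso.symm_hom, Iso.symm_hom, ← cancel_epi (l A).hom, ← cancel_mono (l B).hom]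
    simp [naturality f]

end HalfBraiding

/-! ## The elliptic Drinfeld center -/

/-- An object `(X, λ¹, λ²)` of the elliptic Drinfeld center of a braided monoidal category:
an object `X` with two half-braidings `λ¹, λ² : - ⊗ X ⟶ X ⊗ -` such that the two composites
`A ⊗ B ⊗ X ⟶ X ⊗ B ⊗ A`,
`(id_X ⊗ c_{A,B}) ∘ (λ¹_A ⊗ id_B) ∘ (id_A ⊗ λ²_B)` and
`(λ²_B ⊗ id_A) ∘ (id_B ⊗ λ¹_A) ∘ (c_{B,A}⁻¹ ⊗ id_X)`, agree. -/
structure EllipticCenter (C : Type u) [Category.{v} C] [MonoidalCategory C]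
    [BraidedCategory C] where
  X : C
  lam₁ : HalfBraiding X
  lam₂ : HalfBraiding X
  comm : ∀ A B : C,
    A ◁ (lam₂.lam B).hom ≫ (α_ A X B).inv ≫ (lam₁.lam A).hom ▷ B ≫ (α_ X A B).hom ≫
        X ◁ (β_ A B).hom =
      (α_ A B X).inv ≫ (β_ B A).inv ▷ X ≫ (α_ B A X).hom ≫ B ◁ (lam₁.lam A).hom ≫
        (α_ B X A).inv ≫ (lam₂.lam B).hom ▷ A ≫ (α_ X B A).hom

namespace EllipticCenter

section Category

variable {C : Type u} [Category.{v} C] [MonoidalCategory C] [BraidedCategory C]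

/-- A morphism `(X, λ¹, λ²) ⟶ (Y, μ¹, μ²)` is a morphism `X ⟶ Y` that intertwines both
half-braidings. -/
@[ext]
structure Hom (P Q : EllipticCenter C) where
  f : P.X ⟶ Q.X
  comm₁ : ∀ A : C, A ◁ f ≫ (Q.lam₁.lam A).hom = (P.lam₁.lam A).hom ≫ f ▷ A
  comm₂ : ∀ A : C, A ◁ f ≫ (Q.lam₂.lam A).hom = (P.lam₂.lam A).hom ≫ f ▷ A

instance : Category (EllipticCenter C) where
  Hom P Q := Hom P Q
  id P := ⟨𝟙 P.X, by simp, by simp⟩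
  comp g h := ⟨g.f ≫ h.f,
    fun A => by
      rw [MonoidalCategory.whiskerLeft_comp, Category.assoc, h.comm₁, ← Category.assoc, g.comm₁,
        Category.assoc, comp_whiskerRight],
    fun A => by
      rw [MonoidalCategory.whiskerLeft_comp, Category.assoc, h.comm₂, ← Category.assoc, g.comm₂,
        Category.assoc, comp_whiskerRight]⟩

@[ext]
theorem hom_ext {P Q : EllipticCenter C} {g h : P ⟶ Q} (w : g.f = h.f) : g = h :=
  Hom.ext w

@[simp]
theorem id_f (P : EllipticCenter C) : Hom.f (𝟙 P) = 𝟙 P.X := rfl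

@[simp]
theorem comp_f {P Q R : EllipticCenter C} (g : P ⟶ Q) (h : Q ⟶ R) :
    (g ≫ h).f = g.f ≫ h.f := rfl

end Category

section Preadditive

variable {C : Type u} [Category.{v} C] [Preadditive C] [MonoidalCategory C]
  [MonoidalPreadditive C] [BraidedCategory C]

instance (P Q : EllipticCenter C) : Zero (P ⟶ Q) :=
  ⟨⟨0, by simp, by simp⟩⟩

instance (P Q : EllipticCenter C) : Add (P ⟶ Q) :=
  ⟨fun g h => ⟨g.f + h.f,
    fun A => by simp [MonoidalPreadditive.whiskerLeft_add, MonoidalPreadditive.add_whiskerRight,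
      g.comm₁ A, h.comm₁ A],
    fun A => by simp [MonoidalPreadditive.whiskerLeft_add, MonoidalPreadditive.add_whiskerRight,
      g.comm₂ A, h.comm₂ A]⟩⟩

instance (P Q : EllipticCenter C) : Neg (P ⟶ Q) :=
  ⟨fun g => ⟨-g.f,
    fun A => by
      have hl : A ◁ (-g.f) = -(A ◁ g.f) := (tensorLeft A).map_neg
      have hr : (-g.f) ▷ A = -(g.f ▷ A) := (tensorRight A).map_neg
      rw [hl, hr, Preadditive.neg_comp, Preadditive.comp_neg, g.comm₁ A],
    fun A => by
      have hl : A ◁ (-g.f) = -(A ◁ g.f) := (tensorLeft A).map_neg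
      have hr : (-g.f) ▷ A = -(g.f ▷ A) := (tensorRight A).map_neg
      rw [hl, hr, Preadditive.neg_comp, Preadditive.comp_neg, g.comm₂ A]⟩⟩

/-- The morphisms of the elliptic center form a subgroup of the morphisms of `C`. -/
instance (P Q : EllipticCenter C) : AddCommGroup (P ⟶ Q) where
  add_assoc _ _ _ := hom_ext (add_assoc _ _ _)
  zero_add _ := hom_ext (zero_add _)
  add_zero _ := hom_ext (add_zero _)
  neg_add_cancel _ := hom_ext (neg_add_cancel _)
  add_comm _ _ := hom_ext (add_comm _ _)
  nsmul := nsmulRec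
  zsmul := zsmulRec

@[simp]
theorem zero_f (P Q : EllipticCenter C) : Hom.f (0 : P ⟶ Q) = 0 := rfl

@[simp]
theorem add_f {P Q : EllipticCenter C} (g h : P ⟶ Q) : (g + h).f = g.f + h.f := rfl

@[simp]
theorem neg_f {P Q : EllipticCenter C} (g : P ⟶ Q) : (-g).f = -g.f := rfl

/-- The elliptic center with the addition of morphisms inherited from `C`. -/
instance instPreadditive : Preadditive (EllipticCenter C) where
  add_comp _ _ _ _ _ _ := hom_ext (Preadditive.add_comp _ _ _ _ _ _)
  comp_add _ _ _ _ _ _ := hom_ext (Preadditive.comp_add _ _ _ _ _ _)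

end Preadditive

end EllipticCenter

end

/-! The proof is a Maschke argument. Given half-braidings on `X` and `Y`, a morphism `f : X ⟶ Y` of
`C` is averaged by encircling it with each simple object `X_j`, weighting by `d_j` and dividing by
the global dimension (`HalfBraiding.average`). The weighted loop slides across every object
(`sum_sandwich_eq`), so the average is an intertwiner. An intertwiner leaves the loop unchanged,
each loop then evaluates to `d_j`, and the total weight `∑ d_j ^ 2` cancels because it is nonzero.
Averaging also commutes with composition by intertwiners on either side.

In the elliptic center one averages over `λ¹` and then over `λ²`. The compatibility of the two
half-braidings makes `λ²_B` itself an intertwiner for the first half-braidings (`intertwines_lam₂`),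
so the second average does not destroy what the first one achieved.

Semisimplicity of `C` gives every morphism `f` some `g` with `f ≫ g ≫ f = f`; averaging `g` gives
the same identity in the center (`EllipticCenter.isRegularMorphism`). With biproducts and split
idempotents lifted from `C` (`exists_retract`), regularity yields abelianness, and every
monomorphism splits. Splitting off summands terminates because the dimension of the endomorphism
space in `C` drops.

For finiteness, averages of morphisms through a fixed `Z` factor in `C` through an object `M`
depending only on `Z`. Each simple object of the center has a nonzero averaged endomorphism through
some simple `Z` of `C`, and nonisomorphic ones sharing the same `Z` give linearly independent
elements of the finite-dimensional `End M`. -/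

namespace CategoryTheory

/-! ### Von Neumann regular morphisms and abelian categories. -/

section Regular

variable {D : Type u} [Category.{v} D]

/-- A morphism `f` is von Neumann regular if `f ≫ g ≫ f = f` for some `g`. -/
def IsRegularMorphism {X Y : D} (f : X ⟶ Y) : Prop := ∃ g : Y ⟶ X, f ≫ g ≫ f = f

theorem IsRegularMorphism.exists_retraction {X Y : D} {f : X ⟶ Y} [Mono f]
    (h : IsRegularMorphism f) : ∃ g : Y ⟶ X, f ≫ g = 𝟙 X := by
  obtain ⟨g, hg⟩ := h
  exact ⟨g, by simp [← cancel_mono f, hg]⟩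

theorem IsRegularMorphism.exists_section {X Y : D} {f : X ⟶ Y} [Epi f]
    (h : IsRegularMorphism f) : ∃ g : Y ⟶ X, g ≫ f = 𝟙 Y := by
  obtain ⟨g, hg⟩ := h
  exact ⟨g, by simp [← cancel_epi f, hg]⟩

variable [Preadditive D]

/-- The morphism `𝟙 - f ≫ g` is an idempotent projecting onto the kernel of `f`, so splitting it
produces the kernel. -/
theorem IsRegularMorphism.hasKernel [IsIdempotentComplete D] {X Y : D} {f : X ⟶ Y}
    (h : IsRegularMorphism f) : HasKernel f := by
  obtain ⟨g, hg⟩ := h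
  obtain ⟨K, i, p, hip, hpi⟩ := IsIdempotentComplete.idempotents_split X (𝟙 X - f ≫ g)
    (Idempotents.idem_of_id_sub_idem _ (by rw [Category.assoc, reassoc_of% hg]))
  have hif : i ≫ f = 0 := by
    have h1 : p ≫ i ≫ f = 0 := by
      rw [← Category.assoc, hpi, Preadditive.sub_comp, Category.id_comp, Category.assoc, hg,
        sub_self]
    rw [← Category.id_comp (i ≫ f), ← hip, Category.assoc, h1, comp_zero]
  refine ⟨⟨⟨KernelFork.ofι i hif, ?_⟩⟩⟩
  have : Mono i := mono_of_mono_fac hip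
  refine KernelFork.IsLimit.ofι' i hif fun {A} k hk => ⟨k ≫ p, ?_⟩
  rw [Category.assoc, hpi, Preadditive.comp_sub, reassoc_of% hk, zero_comp, sub_zero,
    Category.comp_id]

theorem IsRegularMorphism.hasCokernel [IsIdempotentComplete D] {X Y : D} {f : X ⟶ Y}
    (h : IsRegularMorphism f) : HasCokernel f := by
  obtain ⟨g, hg⟩ := h
  obtain ⟨K, i, p, hip, hpi⟩ := IsIdempotentComplete.idempotents_split Y (𝟙 Y - g ≫ f)
    (Idempotents.idem_of_id_sub_idem _ (by rw [Category.assoc, hg]))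
  have hfp : f ≫ p = 0 := by
    have h1 : f ≫ p ≫ i = 0 := by
      rw [hpi, Preadditive.comp_sub, Category.comp_id, hg, sub_self]
    rw [← Category.comp_id (f ≫ p), ← hip, ← Category.assoc, Category.assoc f, h1, zero_comp]
  refine ⟨⟨⟨CokernelCofork.ofπ p hfp, ?_⟩⟩⟩
  have : Epi p := epi_of_epi_fac hip
  refine CokernelCofork.IsColimit.ofπ' p hfp fun {A} k hk => ⟨i ≫ k, ?_⟩
  rw [← Category.assoc, hpi, Preadditive.sub_comp, Category.assoc, hk, comp_zero, sub_zero,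
    Category.id_comp]

/-- A preadditive category with finite products and split idempotents in which every morphism is
von Neumann regular is abelian. -/
@[reducible]
noncomputable def Abelian.ofRegular (D : Type u) [Category.{v} D] [I : Preadditive D]
    [HasFiniteProducts D] [IsIdempotentComplete D]
    (h : ∀ {X Y : D} (f : X ⟶ Y), IsRegularMorphism f) : Abelian D where
  toPreadditive := I
  normalMonoOfMono {X Y} f _ := by
    obtain ⟨g, hg⟩ := (h f).exists_retraction
    -- A split monomorphism is the kernel of the idempotent complementary to its image.
    have w : f ≫ (𝟙 Y - g ≫ f) = 0 := by
      rw [Preadditive.comp_sub, Category.comp_id, reassoc_of% hg, sub_self]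
    exact ⟨
      { Z := Y
        g := 𝟙 Y - g ≫ f
        w := w
        isLimit := KernelFork.IsLimit.ofι' f w fun k hk => ⟨k ≫ g, by
          rw [Preadditive.comp_sub, Category.comp_id, sub_eq_zero] at hk
          rw [Category.assoc, ← hk]⟩ }⟩
  normalEpiOfEpi {X Y} f _ := by
    obtain ⟨g, hg⟩ := (h f).exists_section
    have w : (𝟙 X - f ≫ g) ≫ f = 0 := by
      rw [Preadditive.sub_comp, Category.id_comp, Category.assoc, hg, Category.comp_id, sub_self]
    exact ⟨
      { W := X
        g := 𝟙 X - f ≫ g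
        w := w
        isColimit := CokernelCofork.IsColimit.ofπ' f w fun k hk => ⟨g ≫ k, by
          rw [Preadditive.sub_comp, Category.id_comp, sub_eq_zero] at hk
          rw [← Category.assoc, ← hk]⟩ }⟩
  has_kernels := ⟨fun f => (h f).hasKernel⟩
  has_cokernels := ⟨fun f => (h f).hasCokernel⟩

end Regular

end CategoryTheory

/-! ### Direct sum decompositions into simple objects. -/

section Semisimple

variable {D : Type u} [Category.{v} D] [Preadditive D]

/-- `X` decomposes into a finite direct sum of simple objects. -/
def HasSimpleDecomposition (X : D) : Prop :=
  ∃ (n : ℕ) (S : Fin n → D) (ι : ∀ s, S s ⟶ X) (π : ∀ s, X ⟶ S s),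
    (∀ s, Simple (S s)) ∧ (∀ s, ι s ≫ π s = 𝟙 (S s)) ∧ (∀ s t, s ≠ t → ι s ≫ π t = 0) ∧
      ∑ s, π s ≫ ι s = 𝟙 X

theorem HasSimpleDecomposition.of_fintype {X : D} {T : Type} [Fintype T] (S : T → D)
    (ι : ∀ s, S s ⟶ X) (π : ∀ s, X ⟶ S s) (h₁ : ∀ s, Simple (S s))
    (h₂ : ∀ s, ι s ≫ π s = 𝟙 (S s)) (h₃ : ∀ s t, s ≠ t → ι s ≫ π t = 0)
    (h₄ : ∑ s, π s ≫ ι s = 𝟙 X) : HasSimpleDecomposition X := by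
  let e := Fintype.equivFin T
  refine ⟨Fintype.card T, fun s => S (e.symm s), fun s => ι _, fun s => π _, fun s => h₁ _,
    fun s => h₂ _, fun s t hst => h₃ _ _ (by simpa using hst), ?_⟩
  rw [← h₄]
  exact Equiv.sum_comp e.symm fun s => π s ≫ ι s

theorem isSemisimpleCategory_of_hasSimpleDecomposition (h : ∀ X : D, HasSimpleDecomposition X) :
    IsSemisimpleCategory D := by
  intro X
  obtain ⟨n, S, ι, π, hS, hi, ho, ht⟩ := h X
  refine ⟨n, S, ⟨X, π, ι, ?_⟩, hS, ⟨isBilimitOfTotal _ ht⟩, ⟨Iso.refl X⟩⟩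
  intro s t
  split_ifs with hst
  · subst hst
    simpa using hi s
  · exact ho s t hst

theorem IsSemisimpleCategory.hasSimpleDecomposition (h : IsSemisimpleCategory D) (X : D) :
    HasSimpleDecomposition X := by
  obtain ⟨n, S, b, hS, ⟨hb⟩, ⟨e⟩⟩ := h X
  refine ⟨n, S, fun s => b.ι s ≫ e.hom, fun s => e.inv ≫ b.π s, hS, ?_, ?_, ?_⟩
  · intro s
    simp
  · intro s t hst
    simp [b.ι_π, hst]
  · have : ∑ s, b.π s ≫ b.ι s = 𝟙 b.pt := IsBilimit.total hb
    have h2 : ∑ s, (e.inv ≫ b.π s) ≫ b.ι s ≫ e.hom = e.inv ≫ (∑ s, b.π s ≫ b.ι s) ≫ e.hom := by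
      simp [Preadditive.sum_comp, Preadditive.comp_sum]
    rw [h2, this]
    simp

theorem HasSimpleDecomposition.of_isZero {X : D} (h : IsZero X) : HasSimpleDecomposition X :=
  HasSimpleDecomposition.of_fintype (T := PEmpty) (fun s => s.elim) (fun s => s.elim)
    (fun s => s.elim) (fun s => s.elim) (fun s => s.elim) (fun s => s.elim) (h.eq_of_src _ _)

theorem HasSimpleDecomposition.of_simple {X : D} (h : Simple X) : HasSimpleDecomposition X :=
  HasSimpleDecomposition.of_fintype (T := Unit) (fun _ => X) (fun _ => 𝟙 X) (fun _ => 𝟙 X)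
    (fun _ => h) (by simp) (by simp) (by simp)

theorem HasSimpleDecomposition.of_sum {X Y Z : D} {i : Y ⟶ X} {p : X ⟶ Y} {j : Z ⟶ X} {q : X ⟶ Z}
    (hip : i ≫ p = 𝟙 Y) (hjq : j ≫ q = 𝟙 Z) (ht : p ≫ i + q ≫ j = 𝟙 X)
    (hY : HasSimpleDecomposition Y) (hZ : HasSimpleDecomposition Z) :
    HasSimpleDecomposition X := by
  have hiq : i ≫ q = 0 := by
    have h := i ≫= ht =≫ q
    simpa [reassoc_of% hip, hjq] using h
  have hjp : j ≫ p = 0 := by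
    have h := j ≫= ht =≫ p
    simpa [reassoc_of% hjq, hip] using h
  obtain ⟨n, S, ι, π, hS, hi, ho, hs⟩ := hY
  obtain ⟨m, S', ι', π', hS', hi', ho', hs'⟩ := hZ
  refine HasSimpleDecomposition.of_fintype (T := Fin n ⊕ Fin m) (Sum.elim S S')
    (fun s => match s with | .inl s => ι s ≫ i | .inr s => ι' s ≫ j)
    (fun s => match s with | .inl s => p ≫ π s | .inr s => q ≫ π' s) ?_ ?_ ?_ ?_
  · rintro (s | s)
    exacts [hS s, hS' s]
  · rintro (s | s)
    · simpa [reassoc_of% hip] using hi s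
    · simpa [reassoc_of% hjq] using hi' s
  · rintro (s | s) (t | t) hst
    · change (ι s ≫ i) ≫ p ≫ π t = 0
      rw [Category.assoc, reassoc_of% hip, ho s t fun hst' => hst (congrArg _ hst')]
    · change (ι s ≫ i) ≫ q ≫ π' t = 0
      rw [Category.assoc, reassoc_of% hiq, zero_comp, comp_zero]
    · change (ι' s ≫ j) ≫ p ≫ π t = 0
      rw [Category.assoc, reassoc_of% hjp, zero_comp, comp_zero]
    · change (ι' s ≫ j) ≫ q ≫ π' t = 0
      rw [Category.assoc, reassoc_of% hjq, ho' s t fun hst' => hst (congrArg _ hst')]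
  · have h1 : ∑ s, (p ≫ π s) ≫ ι s ≫ i = p ≫ (∑ s, π s ≫ ι s) ≫ i := by
      simp [Preadditive.sum_comp, Preadditive.comp_sum]
    have h2 : ∑ s, (q ≫ π' s) ≫ ι' s ≫ j = q ≫ (∑ s, π' s ≫ ι' s) ≫ j := by
      simp [Preadditive.sum_comp, Preadditive.comp_sum]
    simp only [Fintype.sum_sum_type]
    erw [h1, h2]
    rw [hs, hs']
    simpa using ht

/-- If all morphisms are von Neumann regular and idempotents split, then a size that strictly
decreases under nontrivial direct sum decompositions yields semisimplicity. -/
theorem isSemisimpleCategory_of_regular [IsIdempotentComplete D]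
    (h : ∀ {X Y : D} (f : X ⟶ Y), IsRegularMorphism f) (m : D → ℕ)
    (hm : ∀ {X Y Z : D} (i : Y ⟶ X) (p : X ⟶ Y) (j : Z ⟶ X) (q : X ⟶ Z), i ≫ p = 𝟙 Y →
      j ≫ q = 𝟙 Z → p ≫ i + q ≫ j = 𝟙 X → ¬ IsZero Z → m Y < m X) :
    IsSemisimpleCategory D := by
  apply isSemisimpleCategory_of_hasSimpleDecomposition
  suffices ∀ (n : ℕ) (X : D), m X < n → HasSimpleDecomposition X from
    fun X => this (m X + 1) X (Nat.lt_succ_self _)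
  intro n
  induction n with
  | zero => intro X hX; omega
  | succ n ih =>
    intro X hX
    by_cases hz : IsZero X
    · exact .of_isZero hz
    by_cases hs : Simple X
    · exact .of_simple hs
    have : ∃ (Y : D) (f : Y ⟶ X), Mono f ∧ ¬ IsIso f ∧ f ≠ 0 := by
      by_contra! hcon
      refine hs ⟨fun {Y} f hf => ⟨fun hiso h0 => hz ?_, fun h0 => ?_⟩⟩
      · subst h0
        have : 𝟙 X = 0 := by
          rw [← IsIso.inv_hom_id (0 : Y ⟶ X), comp_zero]
        exact (IsZero.iff_id_eq_zero X).2 this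
      · by_contra hiso
        exact h0 (hcon Y f hf hiso)
    obtain ⟨Y, f, hf, hiso, h0⟩ := this
    obtain ⟨g, hg⟩ := (h f).exists_retraction
    obtain ⟨Z, j, q, hjq, hqj⟩ := IsIdempotentComplete.idempotents_split X (𝟙 X - g ≫ f)
      (Idempotents.idem_of_id_sub_idem _ (by rw [Category.assoc, reassoc_of% hg]))
    have ht : g ≫ f + q ≫ j = 𝟙 X := by rw [hqj]; abel
    -- A zero complement would make `g` a two-sided inverse of `f`.
    have hZ : ¬ IsZero Z := fun hZ => hiso ⟨g, hg, by
      rw [← ht, hZ.eq_of_tgt q 0, zero_comp, add_zero]⟩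
    have hY : ¬ IsZero Y := fun hY => h0 (hY.eq_of_src _ _)
    have h1 := hm f g j q hg hjq ht hZ
    have h2 := hm j q f g hjq hg (by rw [add_comm, ht]) hY
    exact .of_sum hg hjq ht (ih Y (by omega)) (ih Z (by omega))

end Semisimple

/-! ### Projectivity and regularity in semisimple abelian categories. -/

section SemisimpleAbelian

variable {C : Type u} [Category.{v} C] [Abelian C]

/-- The pullback of the epimorphism maps onto `S`, so some simple summand of it maps nontrivially to
`S`. By Schur that map is invertible, and its inverse gives the lift. -/
theorem projective_of_simple (h : IsSemisimpleCategory C) (S : C) [Simple S] : Projective S := by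
  refine ⟨fun {E X} f e _ => ?_⟩
  by_cases hf : f = 0
  · exact ⟨0, by simp [hf]⟩
  have : Mono f := mono_of_nonzero_from_simple hf
  let P := pullback f e
  have hne : pullback.fst f e ≠ 0 := by
    intro h0
    have : Epi (0 : P ⟶ S) := h0 ▸ (inferInstance : Epi (pullback.fst f e))
    exact id_nonzero S ((cancel_epi (0 : P ⟶ S)).1 (by simp))
  obtain ⟨n, T, ι, π, hT, -, -, ht⟩ := h.hasSimpleDecomposition P
  have : ∃ s, ι s ≫ pullback.fst f e ≠ 0 := by
    by_contra! hcon
    apply hne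
    rw [← Category.id_comp (pullback.fst f e), ← ht, Preadditive.sum_comp]
    exact Finset.sum_eq_zero fun s _ => by rw [Category.assoc, hcon s, comp_zero]
  obtain ⟨s, hs⟩ := this
  have := hT s
  have := isIso_of_hom_simple hs
  refine ⟨inv (ι s ≫ pullback.fst f e) ≫ ι s ≫ pullback.snd f e, ?_⟩
  rw [Category.assoc, Category.assoc, ← pullback.condition, IsIso.inv_comp_eq, Category.assoc]

theorem projective_of_isSemisimpleCategory (h : IsSemisimpleCategory C) (X : C) :
    Projective X := by
  obtain ⟨n, S, ι, π, hS, -, -, ht⟩ := h.hasSimpleDecomposition X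
  have hp : ∀ s, Projective (S s) := fun s => have := hS s; projective_of_simple h (S s)
  refine ⟨fun {E Y} f e _ => ⟨∑ s, π s ≫ Projective.factorThru (ι s ≫ f) e, ?_⟩⟩
  simp only [Preadditive.sum_comp, Category.assoc, Projective.factorThru_comp]
  conv_rhs => rw [← Category.id_comp f, ← ht, Preadditive.sum_comp]
  simp

/-- Projectivity splits both halves of the epi-mono factorization of `f`; the quasi-inverse is the
retraction `r` of the image inclusion followed by the section `s` of the projection onto the image.
-/
theorem isRegularMorphism_of_isSemisimpleCategory (h : IsSemisimpleCategory C) {X Y : C}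
    (f : X ⟶ Y) : IsRegularMorphism f := by
  have := projective_of_isSemisimpleCategory h (Abelian.image f)
  have := projective_of_isSemisimpleCategory h (cokernel (Abelian.image.ι f))
  let s := Projective.factorThru (𝟙 _) (Abelian.factorThruImage f)
  have hs : s ≫ Abelian.factorThruImage f = 𝟙 _ := Projective.factorThru_comp _ _
  let c := Projective.factorThru (𝟙 _) (cokernel.π (Abelian.image.ι f))
  have hc : c ≫ cokernel.π (Abelian.image.ι f) = 𝟙 _ := Projective.factorThru_comp _ _
  have hm := Abelian.monoIsKernelOfCokernel _
    (colimit.isColimit (parallelPair (Abelian.image.ι f) 0))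
  obtain ⟨r, hr⟩ := KernelFork.IsLimit.lift' hm (𝟙 Y - cokernel.π (Abelian.image.ι f) ≫ c) (by
    change (𝟙 Y - cokernel.π (Abelian.image.ι f) ≫ c) ≫ cokernel.π (Abelian.image.ι f) = 0
    rw [Preadditive.sub_comp, Category.assoc, hc]; simp)
  change r ≫ Abelian.image.ι f = _ at hr
  have hir : Abelian.image.ι f ≫ r = 𝟙 _ := by
    rw [← cancel_mono (Abelian.image.ι f), Category.assoc, hr]
    simp
  refine ⟨r ≫ s, ?_⟩
  calc f ≫ (r ≫ s) ≫ f
      = Abelian.factorThruImage f ≫ (Abelian.image.ι f ≫ r) ≫ (s ≫ Abelian.factorThruImage f) ≫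
          Abelian.image.ι f := by simp
    _ = f := by rw [hir, hs]; simp

/-- The identity of every object is a finite sum of morphisms factoring through the chosen
representatives of the simple objects. -/
theorem IsSemisimpleCategory.exists_resolution [Fintype (SimpleClass C)]
    (h : IsSemisimpleCategory C) (Q : C) :
    ∃ (n : ℕ) (π : ∀ j : SimpleClass C, Fin n → (Q ⟶ j.rep))
      (ι : ∀ j : SimpleClass C, Fin n → (j.rep ⟶ Q)), ∑ j, ∑ s, π j s ≫ ι j s = 𝟙 Q := by
  classical
  obtain ⟨n, S, ι, π, hS, -, -, ht⟩ := h.hasSimpleDecomposition Q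
  have : ∀ s, ∃ j : SimpleClass C, Nonempty (S s ≅ j.rep) := fun s =>
    ⟨⟨Quotient.mk _ (S s), S s, hS s, rfl⟩,
      (Quotient.mk_out (s := isIsomorphicSetoid C) (S s)).map Iso.symm⟩
  choose c hc using this
  let e := fun s => (hc s).some
  -- The same index set `Fin n` serves every class `j`; entries for summands not of class `j` are
  -- zero.
  refine ⟨n, fun j s => if hj : c s = j then π s ≫ (e s).hom ≫ eqToHom (by rw [hj]) else 0,
    fun j s => if hj : c s = j then eqToHom (by rw [hj]) ≫ (e s).inv ≫ ι s else 0, ?_⟩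
  rw [Finset.sum_comm, ← ht]
  refine Finset.sum_congr rfl fun s _ => ?_
  rw [Finset.sum_eq_single (c s)]
  · simp
  · intro j _ hj
    simp [hj.symm]
  · simp

end SemisimpleAbelian

/-! ### Duals, partial traces and ribbon structure. -/

section Rigid

variable {C : Type u} [Category.{v} C] [MonoidalCategory C]

theorem rightAdjointMate_sum [Preadditive C] [MonoidalPreadditive C] {X Y : C} [HasRightDual X]
    [HasRightDual Y] {T : Type*} (s : Finset T) (f : T → (X ⟶ Y)) :
    rightAdjointMate (∑ t ∈ s, f t) = ∑ t ∈ s, rightAdjointMate (f t) := by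
  simp [rightAdjointMate, whiskerLeft_sum, sum_whiskerRight, Preadditive.sum_comp,
    Preadditive.comp_sum]

/-- The identity of every object is a finite sum of morphisms factoring through the right duals of
the chosen representatives of the simple objects. -/
theorem IsSemisimpleCategory.exists_dual_resolution {C : Type u} [Category.{v} C] [Abelian C]
    [MonoidalCategory C] [MonoidalPreadditive C] [RigidCategory C] [Fintype (SimpleClass C)]
    (h : IsSemisimpleCategory C) (W : C) :
    ∃ (n : ℕ) (ρ : ∀ j : SimpleClass C, Fin n → (W ⟶ (j.rep)ᘁ))
      (κ : ∀ j : SimpleClass C, Fin n → ((j.rep)ᘁ ⟶ W)), ∑ j, ∑ s, ρ j s ≫ κ j s = 𝟙 W := by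
  -- `W` is the right dual of its left dual, so dualizing a resolution of `ᘁW` works; dualization
  -- exchanges projections and inclusions.
  obtain ⟨n, π, ι, ht⟩ := h.exists_resolution (ᘁW)
  let e : W ≅ (ᘁW)ᘁ := rightDualIso (X := ᘁW) inferInstance inferInstance
  refine ⟨n, fun j s => e.hom ≫ rightAdjointMate (ι j s),
    fun j s => rightAdjointMate (π j s) ≫ e.inv, ?_⟩
  have h1 : ∑ j, ∑ s, rightAdjointMate (ι j s) ≫ rightAdjointMate (π j s) = 𝟙 ((ᘁW)ᘁ) := by
    rw [← rightAdjointMate_id, ← ht]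
    simp_rw [← comp_rightAdjointMate, rightAdjointMate_sum]
  calc _ = e.hom ≫ (∑ j, ∑ s, rightAdjointMate (ι j s) ≫ rightAdjointMate (π j s)) ≫ e.inv := by
        simp [Preadditive.comp_sum, Preadditive.sum_comp]
    _ = _ := by rw [h1]; simp

end Rigid

section PartialTrace

variable {C : Type u} [Category.{v} C] [MonoidalCategory C]

/-- The two ways of closing an endomorphism of `M ⊗ N` on both sides, one side at a time, agree. -/
theorem leftPartialTrace_rightPartialTrace {L M N R : C} (c₁ : 𝟙_ C ⟶ L ⊗ M) (e₁ : L ⊗ M ⟶ 𝟙_ C)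
    (c₂ : 𝟙_ C ⟶ N ⊗ R) (e₂ : N ⊗ R ⟶ 𝟙_ C) (w : M ⊗ N ⟶ M ⊗ N) :
    c₂ ≫ ((λ_ N).inv ≫ c₁ ▷ N ≫ (α_ L M N).hom ≫ L ◁ w ≫ (α_ L M N).inv ≫ e₁ ▷ N ≫
        (λ_ N).hom) ▷ R ≫ e₂ =
      c₁ ≫ L ◁ ((ρ_ M).inv ≫ M ◁ c₂ ≫ (α_ M N R).inv ≫ w ▷ R ≫ (α_ M N R).hom ≫ M ◁ e₂ ≫
        (ρ_ M).hom) ≫ e₁ := by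
  calc _ = 𝟙 _ ⊗≫ (𝟙_ C ◁ c₂ ≫ c₁ ▷ (N ⊗ R)) ⊗≫ L ◁ w ▷ R ⊗≫
          (e₁ ▷ (N ⊗ R) ≫ 𝟙_ C ◁ e₂) ⊗≫ 𝟙 _ := by monoidal
    _ = 𝟙 _ ⊗≫ (c₁ ▷ 𝟙_ C ≫ (L ⊗ M) ◁ c₂) ⊗≫ L ◁ w ▷ R ⊗≫
          ((L ⊗ M) ◁ e₂ ≫ e₁ ▷ 𝟙_ C) ⊗≫ 𝟙 _ := by rw [whisker_exchange, whisker_exchange]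
    _ = _ := by monoidal

end PartialTrace

section Ribbon

variable {C : Type u} [Category.{v} C] [MonoidalCategory C] [BraidedCategory C] [RigidCategory C]
  [RibbonCategory C]

/-- In a ribbon category, the dual is also a dual on the other side. -/
@[reducible]
def ribbonPairing (X : C) : ExactPairing (Xᘁ) X :=
  letI := BraidedCategory.exactPairing_swap X (Xᘁ)
  exactPairingCongrRight (RibbonCategory.twist X)

/-- The evaluation `X ⊗ X^* ⟶ 𝟙`. -/
def ribbonEv (X : C) : X ⊗ Xᘁ ⟶ 𝟙_ C := @ExactPairing.evaluation C _ _ (Xᘁ) X (ribbonPairing X)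

/-- The coevaluation `𝟙 ⟶ X^* ⊗ X`. -/
def ribbonCoev (X : C) : 𝟙_ C ⟶ Xᘁ ⊗ X :=
  @ExactPairing.coevaluation C _ _ (Xᘁ) X (ribbonPairing X)

theorem ribbonEv_eq (X : C) :
    ribbonEv X = (RibbonCategory.twist X).hom ▷ Xᘁ ≫ (β_ X (Xᘁ)).hom ≫ ε_ X (Xᘁ) := rfl

theorem ribbonCoev_eq (X : C) :
    ribbonCoev X = (η_ X (Xᘁ) ≫ (β_ (Xᘁ) X).inv) ≫ (Xᘁ) ◁ (RibbonCategory.twist X).inv := rfl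

theorem coevaluation_ribbonEv (X : C) : η_ X (Xᘁ) ≫ ribbonEv X = categoricalDim X := rfl

/-- The braiding of the unit with itself is trivial, so its twist is idempotent as well as
invertible. -/
theorem twist_unit : (RibbonCategory.twist (𝟙_ C)).hom = 𝟙 (𝟙_ C) := by
  have h := RibbonCategory.twist_tensor (𝟙_ C) (𝟙_ C)
  have h2 := RibbonCategory.twist_naturality (λ_ (𝟙_ C)).hom
  have hb : (β_ (𝟙_ C) (𝟙_ C)).hom = 𝟙 _ := by
    rw [braiding_tensorUnit_left]; simp [unitors_equal]
  rw [h, hb] at h2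
  have h3 : (RibbonCategory.twist (𝟙_ C)).hom ≫ (RibbonCategory.twist (𝟙_ C)).hom =
      (RibbonCategory.twist (𝟙_ C)).hom := by
    rw [← cancel_epi (λ_ (𝟙_ C)).hom, h2]
    simp [MonoidalCategory.tensorHom_def, unitors_equal, unitors_inv_equal]
  rw [← cancel_mono (RibbonCategory.twist (𝟙_ C)).hom, h3, Category.id_comp]

/-- The loop has the same value in both orientations. Naturality of the twist at the coevaluation
turns the inverse braiding and twist into positive ones with the twist on `Xᘁ`, and self-duality of
the twist carries it back to `X`. -/
theorem ribbonCoev_evaluation (X : C) : ribbonCoev X ≫ ε_ X (Xᘁ) = categoricalDim X := by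
  have h := RibbonCategory.twist_naturality (η_ X (Xᘁ))
  rw [twist_unit, Category.id_comp, RibbonCategory.twist_tensor] at h
  have h2 : ribbonCoev X = η_ X (Xᘁ) ≫ (β_ X (Xᘁ)).hom ≫ (RibbonCategory.twist (Xᘁ)).hom ▷ X := by
    rw [ribbonCoev_eq]
    conv_lhs => rw [← h]
    simp [MonoidalCategory.tensorHom_def', ← MonoidalCategory.whiskerLeft_comp]
  rw [h2, ← RibbonCategory.twist_dual, ← coevaluation_ribbonEv, ribbonEv_eq]
  simp [rightAdjointMate_comp_evaluation]

end Ribbon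

section Mates

variable {C : Type u} [Category.{v} C] [MonoidalCategory C] [BraidedCategory C] [RigidCategory C]
  [RibbonCategory C]

/-- The correspondence between morphisms `X ⊗ A ⟶ Y` and morphisms `A ⟶ X^* ⊗ Y`. -/
def leftMate (X A Y : C) : (X ⊗ A ⟶ Y) ≃ (A ⟶ Xᘁ ⊗ Y) :=
  letI := ribbonPairing X
  tensorLeftHomEquiv A (Xᘁ) X Y

/-- The correspondence between morphisms `A ⊗ Y^* ⟶ X` and morphisms `A ⟶ X ⊗ Y`. -/
def rightMate (A Y X : C) : (A ⊗ Yᘁ ⟶ X) ≃ (A ⟶ X ⊗ Y) :=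
  letI := ribbonPairing Y
  tensorRightHomEquiv A (Yᘁ) Y X

theorem leftMate_apply {X A Y : C} (f : X ⊗ A ⟶ Y) :
    leftMate X A Y f = (λ_ A).inv ≫ ribbonCoev X ▷ A ≫ (α_ _ _ _).hom ≫ (Xᘁ) ◁ f := rfl

theorem leftMate_symm_apply {X A Y : C} (f : A ⟶ Xᘁ ⊗ Y) :
    (leftMate X A Y).symm f = X ◁ f ≫ (α_ _ _ _).inv ≫ ribbonEv X ▷ Y ≫ (λ_ Y).hom := rfl

theorem rightMate_apply {A Y X : C} (f : A ⊗ Yᘁ ⟶ X) :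
    rightMate A Y X f = (ρ_ A).inv ≫ A ◁ ribbonCoev Y ≫ (α_ _ _ _).inv ≫ f ▷ Y := rfl

theorem rightMate_symm_apply {A Y X : C} (f : A ⟶ X ⊗ Y) :
    (rightMate A Y X).symm f = f ▷ Yᘁ ≫ (α_ _ _ _).hom ≫ X ◁ ribbonEv Y ≫ (ρ_ X).hom := rfl

/-- The traces of the two endomorphisms built from `u : A ⟶ X^* ⊗ Y` and `v : X^* ⊗ Y ⟶ A` by
partial closure agree. -/
theorem trace_mates {X Y A : C} (u : A ⟶ Xᘁ ⊗ Y) (v : Xᘁ ⊗ Y ⟶ A) :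
    η_ Y (Yᘁ) ≫ (tensorLeftHomEquiv Y X (Xᘁ) A v ≫ (leftMate X A Y).symm u) ▷ Yᘁ ≫ ribbonEv Y =
      η_ X (Xᘁ) ≫ X ◁ (tensorRightHomEquiv (Xᘁ) Y (Yᘁ) A v ≫ (rightMate A Y (Xᘁ)).symm u) ≫
        ribbonEv X := by
  have h := leftPartialTrace_rightPartialTrace (η_ X (Xᘁ)) (ribbonEv X) (η_ Y (Yᘁ)) (ribbonEv Y)
    (v ≫ u)
  simpa [tensorLeftHomEquiv, tensorRightHomEquiv, leftMate_symm_apply, rightMate_symm_apply]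
    using h

end Mates

section RightAdjointMate

variable {C : Type u} [Category.{v} C] [MonoidalCategory C]

theorem rightAdjointMate_eq {X Y : C} [HasRightDual X] [HasRightDual Y] (f : X ⟶ Y) :
    rightAdjointMate f =
      tensorRightHomEquiv (Yᘁ) X (Xᘁ) (𝟙_ C)
        ((tensorLeftHomEquiv X Y (Yᘁ) (𝟙_ C)).symm (f ≫ (ρ_ Y).inv)) ≫ (λ_ _).hom := by
  simp only [rightAdjointMate, tensorRightHomEquiv, tensorLeftHomEquiv, Equiv.coe_fn_mk,
    Equiv.coe_fn_symm_mk]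
  monoidal

/-- Dualization is a composite of adjunction bijections. Surjectivity transports Schur's lemma from
simple objects to their duals. -/
theorem rightAdjointMate_surjective {X Y : C} [HasRightDual X] [HasRightDual Y] :
    Function.Surjective (rightAdjointMate : (X ⟶ Y) → (Yᘁ ⟶ Xᘁ)) := by
  intro g
  refine ⟨tensorLeftHomEquiv X Y (Yᘁ) (𝟙_ C)
    ((tensorRightHomEquiv (Yᘁ) X (Xᘁ) (𝟙_ C)).symm (g ≫ (λ_ _).inv)) ≫ (ρ_ Y).hom, ?_⟩
  simp [rightAdjointMate_eq]

theorem rightAdjointMate_zero [Preadditive C] [MonoidalPreadditive C] {X Y : C} [HasRightDual X]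
    [HasRightDual Y] : rightAdjointMate (0 : X ⟶ Y) = 0 := by
  simp [rightAdjointMate]

theorem rightAdjointMate_smul {k : Type w} [Field k] [Preadditive C] [Linear k C]
    [MonoidalPreadditive C] [MonoidalLinear k C] {X Y : C} [HasRightDual X]
    [HasRightDual Y] (c : k) (f : X ⟶ Y) : rightAdjointMate (c • f) = c • rightAdjointMate f := by
  simp [rightAdjointMate]

end RightAdjointMate

/-! ### Encircling by a natural transformation and conjugation by half-braidings. -/

section Sandwich

variable {C : Type u} [Category.{v} C] [MonoidalCategory C]

/-- The morphism `A ⊗ X ⟶ D ⊗ Q ⊗ X ⟶ D ⊗ Q ⊗ Y ⟶ A' ⊗ Y` with `θ_Q` in the middle. -/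
def sandwich {X Y : C} (θ : ∀ Q : C, Q ⊗ X ⟶ Q ⊗ Y) {A A' D Q : C} (u : A ⟶ D ⊗ Q)
    (v : D ⊗ Q ⟶ A') : A ⊗ X ⟶ A' ⊗ Y :=
  u ▷ X ≫ (α_ D Q X).hom ≫ D ◁ θ Q ≫ (α_ D Q Y).inv ≫ v ▷ Y

variable {X Y : C} (θ : ∀ Q : C, Q ⊗ X ⟶ Q ⊗ Y) {A A' D D' Q Q' : C}

theorem sandwich_comp_whiskerRight (u : A ⟶ D ⊗ Q) (d : D ⟶ D') (v : D' ⊗ Q ⟶ A') :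
    sandwich θ (u ≫ d ▷ Q) v = sandwich θ u (d ▷ Q ≫ v) := by
  simp only [sandwich, comp_whiskerRight, Category.assoc, associator_naturality_left_assoc,
    ← associator_inv_naturality_left_assoc, whisker_exchange_assoc]

theorem sandwich_comp_whiskerLeft
    (hθ : ∀ {Q Q' : C} (q : Q ⟶ Q'), q ▷ X ≫ θ Q' = θ Q ≫ q ▷ Y)
    (u : A ⟶ D ⊗ Q) (q : Q ⟶ Q') (v : D ⊗ Q' ⟶ A') :
    sandwich θ (u ≫ D ◁ q) v = sandwich θ u (D ◁ q ≫ v) := by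
  have h : D ◁ q ▷ X ≫ D ◁ θ Q' = D ◁ θ Q ≫ D ◁ q ▷ Y := by
    rw [← MonoidalCategory.whiskerLeft_comp, hθ, MonoidalCategory.whiskerLeft_comp]
  simp only [sandwich, comp_whiskerRight, Category.assoc, whisker_assoc, Iso.inv_hom_id_assoc,
    reassoc_of% h]

theorem whiskerLeft_sandwich (B : C) (u : 𝟙_ C ⟶ D ⊗ Q) (v : D ⊗ Q ⟶ 𝟙_ C) :
    B ◁ ((λ_ X).inv ≫ sandwich θ u v ≫ (λ_ Y).hom) =
      sandwich θ ((ρ_ B).inv ≫ B ◁ u ≫ (α_ B D Q).inv) ((α_ B D Q).hom ≫ B ◁ v ≫ (ρ_ B).hom) := by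
  simp only [sandwich]
  monoidal

section Linear

variable [Preadditive C] [MonoidalPreadditive C]

theorem sandwich_sum_left {T : Type*} (s : Finset T) (u : T → (A ⟶ D ⊗ Q)) (v : D ⊗ Q ⟶ A') :
    sandwich θ (∑ t ∈ s, u t) v = ∑ t ∈ s, sandwich θ (u t) v := by
  simp [sandwich, sum_whiskerRight, Preadditive.sum_comp]

theorem sandwich_sum_right {T : Type*} (s : Finset T) (u : A ⟶ D ⊗ Q) (v : T → (D ⊗ Q ⟶ A')) :
    sandwich θ u (∑ t ∈ s, v t) = ∑ t ∈ s, sandwich θ u (v t) := by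
  simp [sandwich, sum_whiskerRight, Preadditive.comp_sum]

variable {k : Type w} [Field k] [Linear k C] [MonoidalLinear k C]

theorem sandwich_smul_left (c : k) (u : A ⟶ D ⊗ Q) (v : D ⊗ Q ⟶ A') :
    sandwich θ (c • u) v = c • sandwich θ u v := by
  simp [sandwich]

theorem sandwich_smul_right (c : k) (u : A ⟶ D ⊗ Q) (v : D ⊗ Q ⟶ A') :
    sandwich θ u (c • v) = c • sandwich θ u v := by
  simp [sandwich]

end Linear

end Sandwich

namespace CategoryTheory.HalfBraiding

variable {C : Type u} [Category.{v} C] [MonoidalCategory C] {X Y : C}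

/-- Conjugation of a morphism `f : X ⟶ Y` by half-braidings. -/
def conj (b : HalfBraiding X) (b' : HalfBraiding Y) (f : X ⟶ Y) (Q : C) : Q ⊗ X ⟶ Q ⊗ Y :=
  (b.lam Q).hom ≫ f ▷ Q ≫ (b'.lam Q).inv

variable (b : HalfBraiding X) (b' : HalfBraiding Y)

theorem lam_inv_naturality {A B : C} (f : A ⟶ B) :
    X ◁ f ≫ (b.lam B).inv = (b.lam A).inv ≫ f ▷ X := b.naturality f

theorem conj_naturality (f : X ⟶ Y) {Q Q' : C} (q : Q ⟶ Q') :
    q ▷ X ≫ conj b b' f Q' = conj b b' f Q ≫ q ▷ Y := by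
  simp only [conj, Category.assoc, ← lam_inv_naturality, reassoc_of% b.lam_naturality q]
  rw [whisker_exchange_assoc]

theorem conj_tensor (f : X ⟶ Y) (A B : C) :
    conj b b' f (A ⊗ B) = (α_ A B X).hom ≫ A ◁ (b.lam B).hom ≫ (α_ A X B).inv ≫
      conj b b' f A ▷ B ≫ (α_ A Y B).hom ≫ A ◁ (b'.lam B).inv ≫ (α_ A B Y).inv := by
  have h : (b'.lam (A ⊗ B)).inv = (α_ Y A B).inv ≫ (b'.lam A).inv ▷ B ≫ (α_ A Y B).hom ≫
      A ◁ (b'.lam B).inv ≫ (α_ A B Y).inv := b'.monoidal A B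
  simp only [conj, lam_tensor, h, comp_whiskerRight, Category.assoc]
  simp

/-- Multiplicativity of the half-braidings merges conjugation by `A` with the inner one, so that `A`
joins `Q` inside the loop. In `whiskerLeft_sandwich`, by contrast, `A` stays outside; equality of
the two after summation is the intertwining property. -/
theorem conj_sandwich (f : X ⟶ Y) {D Q : C} (A : C) (u : 𝟙_ C ⟶ D ⊗ Q) (v : D ⊗ Q ⟶ 𝟙_ C) :
    conj b b' ((λ_ X).inv ≫ sandwich (conj b b' f) u v ≫ (λ_ Y).hom) A =
      sandwich (conj b b' f) ((λ_ A).inv ≫ u ▷ A ≫ (α_ D Q A).hom)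
        ((α_ D Q A).inv ≫ v ▷ A ≫ (λ_ A).hom) := by
  rw [sandwich, sandwich, conj_tensor, conj]
  generalize conj b b' f Q = t
  calc _ = 𝟙 _ ⊗≫ (𝟙_ C ◁ (b.lam A).hom ≫ u ▷ (X ⊗ A)) ⊗≫ D ◁ t ▷ A ⊗≫
          (v ▷ (Y ⊗ A) ≫ 𝟙_ C ◁ (b'.lam A).inv) ⊗≫ 𝟙 _ := by monoidal
    _ = 𝟙 _ ⊗≫ (u ▷ (A ⊗ X) ≫ (D ⊗ Q) ◁ (b.lam A).hom) ⊗≫ D ◁ t ▷ A ⊗≫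
          ((D ⊗ Q) ◁ (b'.lam A).inv ≫ v ▷ (A ⊗ Y)) ⊗≫ 𝟙 _ := by
        rw [whisker_exchange, whisker_exchange]
    _ = _ := by monoidal

/-- A morphism intertwines the half-braidings if conjugation by them does not change it. -/
def Intertwines (f : X ⟶ Y) : Prop := ∀ A : C, A ◁ f ≫ (b'.lam A).hom = (b.lam A).hom ≫ f ▷ A

variable {b b'}

theorem intertwines_iff_conj {f : X ⟶ Y} : Intertwines b b' f ↔ ∀ A, conj b b' f A = A ◁ f := by
  refine forall_congr' fun A => ?_
  rw [conj, ← Category.assoc, Iso.comp_inv_eq, eq_comm]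

end CategoryTheory.HalfBraiding

/-! ### The sliding identity for the weighted loop. -/

section Linearity

variable {k : Type w} [Field k] {C : Type u} [Category.{v} C] [Preadditive C] [Linear k C]
  [MonoidalCategory C] [MonoidalPreadditive C] [MonoidalLinear k C]

theorem tensorLeftHomEquiv_symm_sum_smul {X Y Y' Z : C} [ExactPairing Y Y'] {T : Type*}
    [Fintype T] (c : T → k) (f : T → (X ⟶ Y ⊗ Z)) :
    (tensorLeftHomEquiv X Y Y' Z).symm (∑ t, c t • f t) =
      ∑ t, c t • (tensorLeftHomEquiv X Y Y' Z).symm (f t) := by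
  simp [tensorLeftHomEquiv, whiskerLeft_sum, Preadditive.sum_comp]

variable [BraidedCategory C] [RigidCategory C] [RibbonCategory C]

theorem rightMate_sum_smul {A X Y : C} {T : Type*} [Fintype T] (c : T → k)
    (f : T → (A ⊗ Yᘁ ⟶ X)) :
    rightMate A Y X (∑ t, c t • f t) = ∑ t, c t • rightMate A Y X (f t) := by
  simp [rightMate_apply, sum_whiskerRight, Preadditive.comp_sum]

/-- Both sums are expanded in terms of `u' t : A ⟶ Sᘁ ⊗ T` and `v s : Sᘁ ⊗ T ⟶ A`. The coefficients
are the scalars by which the composites act on `T` and on `Sᘁ`, and these agree after weighting by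
`dT` and `dS`. No division by a dimension occurs. -/
theorem sum_sandwich_mates {X Y : C} (θ : ∀ Q : C, Q ⊗ X ⟶ Q ⊗ Y) {S T A : C}
    (h1 : 𝟙 (𝟙_ C) ≠ 0) {dS dT : k} (hS : categoricalDim S = dS • 𝟙 (𝟙_ C))
    (hT : categoricalDim T = dT • 𝟙 (𝟙_ C)) (hendS : ∀ f : Sᘁ ⟶ Sᘁ, ∃ c : k, c • 𝟙 _ = f)
    (hendT : ∀ f : T ⟶ T, ∃ c : k, c • 𝟙 _ = f) {n m : ℕ} {π : Fin n → (S ⊗ A ⟶ T)}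
    {ι : Fin n → (T ⟶ S ⊗ A)} (hι : ∀ g : T ⟶ S ⊗ A, ∑ s, (g ≫ π s) ≫ ι s = g)
    {ρ : Fin m → (A ⊗ Tᘁ ⟶ Sᘁ)} {κ : Fin m → (Sᘁ ⟶ A ⊗ Tᘁ)}
    (hρ : ∀ g : A ⊗ Tᘁ ⟶ Sᘁ, ∑ t, ρ t ≫ κ t ≫ g = g) :
    dS • ∑ s, sandwich θ (leftMate S A T (π s)) ((tensorLeftHomEquiv T S (Sᘁ) A).symm (ι s)) =
      dT • ∑ t, sandwich θ (rightMate A T (Sᘁ) (ρ t))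
        ((tensorRightHomEquiv (Sᘁ) T (Tᘁ) A).symm (κ t)) := by
  set u := fun s => leftMate S A T (π s) with hu
  set u' := fun t => rightMate A T (Sᘁ) (ρ t) with hu'
  set v := fun s => (tensorLeftHomEquiv T S (Sᘁ) A).symm (ι s) with hv
  set v' := fun t => (tensorRightHomEquiv (Sᘁ) T (Tᘁ) A).symm (κ t) with hv'
  choose c hc using fun t s => hendT (tensorLeftHomEquiv T S (Sᘁ) A (v' t) ≫ π s)
  choose b hb using fun t s => hendS (κ t ≫ (rightMate A T (Sᘁ)).symm (u s))
  have hvv : ∀ t, v' t = ∑ s, c t s • v s := fun t => by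
    rw [hv, ← tensorLeftHomEquiv_symm_sum_smul, Equiv.eq_symm_apply,
      ← hι (tensorLeftHomEquiv T S (Sᘁ) A (v' t))]
    refine Finset.sum_congr rfl fun s _ => ?_
    rw [← hc]; simp
  have huu : ∀ s, u s = ∑ t, b t s • u' t := fun s => by
    rw [hu', ← rightMate_sum_smul, ← Equiv.symm_apply_eq, ← hρ ((rightMate A T (Sᘁ)).symm (u s))]
    refine Finset.sum_congr rfl fun t _ => ?_
    rw [← hb]; simp
  -- By `trace_mates`, both products are the full closure of `v' t ≫ u s` on `Sᘁ ⊗ T`.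
  have htr : ∀ t s, dT * c t s = dS * b t s := fun t s => by
    have h := trace_mates (u s) (v' t)
    have e1 : (leftMate S A T).symm (u s) = π s := Equiv.symm_apply_apply _ _
    have e2 : tensorRightHomEquiv (Sᘁ) T (Tᘁ) A (v' t) = κ t := Equiv.apply_symm_apply _ _
    rw [e1, e2, ← hc, ← hb] at h
    simp only [MonoidalLinear.smul_whiskerRight, MonoidalLinear.whiskerLeft_smul, Linear.smul_comp,
      Linear.comp_smul, id_whiskerRight, whiskerLeft_id, Category.id_comp,
      coevaluation_ribbonEv] at h
    rw [hS, hT] at h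
    change c t s • (dT • 𝟙 (𝟙_ C)) = b t s • (dS • 𝟙 (𝟙_ C)) at h
    rw [smul_smul, smul_smul] at h
    have := smul_left_injective k h1 h
    change c t s * dT = b t s * dS at this
    rw [mul_comm dT, this, mul_comm]
  calc dS • ∑ s, sandwich θ (u s) (v s)
      = ∑ s, ∑ t, (dS * b t s) • sandwich θ (u' t) (v s) := by
        rw [Finset.smul_sum]
        refine Finset.sum_congr rfl fun s _ => ?_
        rw [huu s, sandwich_sum_left, Finset.smul_sum]
        simp_rw [sandwich_smul_left, smul_smul]
    _ = ∑ t, ∑ s, (dT * c t s) • sandwich θ (u' t) (v s) := by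
        rw [Finset.sum_comm]
        simp_rw [htr]
    _ = dT • ∑ t, sandwich θ (u' t) (v' t) := by
        rw [Finset.smul_sum]
        refine Finset.sum_congr rfl fun t _ => ?_
        rw [hvv t, sandwich_sum_right, Finset.smul_sum]
        simp_rw [sandwich_smul_right, smul_smul]

end Linearity

section Fusion

variable (k : Type w) [Field k] [IsAlgClosed k] {C : Type u} [Category.{v} C] [Abelian C]
  [Linear k C] [MonoidalCategory C] [MonoidalPreadditive C] [MonoidalLinear k C]
  [RigidCategory C] [IsFusionCategory k C]

theorem SimpleClass.end_eq_smul_id (j : SimpleClass C) (f : j.rep ⟶ j.rep) :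
    ∃ c : k, c • 𝟙 _ = f :=
  have := j.simple_rep
  have := IsFusionCategory.finiteDimensional_hom (k := k) j.rep j.rep
  endomorphism_simple_eq_smul_id k f

theorem SimpleClass.end_dual_eq_smul_id (j : SimpleClass C) (f : (j.rep)ᘁ ⟶ (j.rep)ᘁ) :
    ∃ c : k, c • 𝟙 _ = f := by
  obtain ⟨g, rfl⟩ := rightAdjointMate_surjective f
  obtain ⟨c, rfl⟩ := j.end_eq_smul_id k g
  exact ⟨c, by rw [rightAdjointMate_smul, rightAdjointMate_id]⟩

theorem SimpleClass.eq_of_iso {D : Type u} [Category.{v} D] [Preadditive D] {i j : SimpleClass D}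
    (e : i.rep ≅ j.rep) : i = j := by
  apply Subtype.ext
  rw [← Quotient.out_eq i.1, ← Quotient.out_eq j.1]
  exact Quotient.sound ⟨e⟩

theorem SimpleClass.hom_eq_zero {D : Type u} [Category.{v} D] [Preadditive D] [HasKernels D]
    {i j : SimpleClass D} (h : i ≠ j) (f : i.rep ⟶ j.rep) : f = 0 := by
  have := i.simple_rep
  have := j.simple_rep
  by_contra hf
  have := isIso_of_hom_simple hf
  exact h (SimpleClass.eq_of_iso (asIso f))

theorem SimpleClass.dual_hom_eq_zero {C : Type u} [Category.{v} C] [Abelian C]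
    [MonoidalCategory C] [MonoidalPreadditive C] [RigidCategory C] {i j : SimpleClass C}
    (h : i ≠ j) (f : (i.rep)ᘁ ⟶ (j.rep)ᘁ) : f = 0 := by
  obtain ⟨g, rfl⟩ := rightAdjointMate_surjective f
  rw [SimpleClass.hom_eq_zero h.symm g, rightAdjointMate_zero]

theorem exists_categoricalDim_eq_smul [BraidedCategory C] [RibbonCategory C] (X : C) :
    ∃ c : k, categoricalDim X = c • 𝟙 (𝟙_ C) := by
  have := IsFusionCategory.simple_unit k (C := C)
  have := IsFusionCategory.finiteDimensional_hom (k := k) (𝟙_ C) (𝟙_ C)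
  obtain ⟨c, hc⟩ := endomorphism_simple_eq_smul_id k (categoricalDim X : 𝟙_ C ⟶ 𝟙_ C)
  exact ⟨c, hc.symm⟩

variable [BraidedCategory C] [RibbonCategory C]

/-- The dimensions of the simple objects as scalars. -/
noncomputable def SimpleClass.dim (j : SimpleClass C) : k :=
  (exists_categoricalDim_eq_smul k j.rep).choose

theorem SimpleClass.categoricalDim_rep (j : SimpleClass C) :
    categoricalDim j.rep = j.dim k • 𝟙 (𝟙_ C) := (exists_categoricalDim_eq_smul k j.rep).choose_spec

/-- The weighted sum over the simple objects of the morphisms obtained by encircling with a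
natural transformation passes through every object. -/
theorem sum_sandwich_eq [Fintype (SimpleClass C)] {X Y : C} (θ : ∀ Q : C, Q ⊗ X ⟶ Q ⊗ Y)
    (hθ : ∀ {Q Q' : C} (q : Q ⟶ Q'), q ▷ X ≫ θ Q' = θ Q ≫ q ▷ Y) (A : C) :
    ∑ i : SimpleClass C, i.dim k • sandwich θ
        ((λ_ A).inv ≫ ribbonCoev i.rep ▷ A ≫ (α_ _ _ A).hom)
        ((α_ _ _ A).inv ≫ ε_ i.rep (i.rep)ᘁ ▷ A ≫ (λ_ A).hom) =
      ∑ j : SimpleClass C, j.dim k • sandwich θ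
        ((ρ_ A).inv ≫ A ◁ ribbonCoev j.rep ≫ (α_ A _ _).inv)
        ((α_ A _ _).hom ≫ A ◁ ε_ j.rep (j.rep)ᘁ ≫ (ρ_ A).hom) := by
  have hss := IsFusionCategory.semisimple k (C := C)
  have h1 : 𝟙 (𝟙_ C) ≠ 0 := have := IsFusionCategory.simple_unit k (C := C); id_nonzero _
  -- On the left, `X_i ⊗ A` is the strand carrying `θ` and is resolved by simples `X_j`; on the
  -- right, the spectator `A ⊗ X_jᘁ` is resolved by duals `X_iᘁ`. Both sides become double sums
  -- through `X_iᘁ ⊗ X_j`, compared pair by pair.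
  choose n π ι hπι using fun i : SimpleClass C => hss.exists_resolution (i.rep ⊗ A)
  choose m ρ κ hρκ using fun j : SimpleClass C => hss.exists_dual_resolution (A ⊗ (j.rep)ᘁ)
  have hl : ∀ i : SimpleClass C, sandwich θ
        ((λ_ A).inv ≫ ribbonCoev i.rep ▷ A ≫ (α_ _ _ A).hom)
        ((α_ _ _ A).inv ≫ ε_ i.rep (i.rep)ᘁ ▷ A ≫ (λ_ A).hom) =
      ∑ j, ∑ s, sandwich θ (leftMate i.rep A j.rep (π i j s))
        ((tensorLeftHomEquiv j.rep i.rep _ A).symm (ι i j s)) := fun i => by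
    set v := (α_ _ _ A).inv ≫ ε_ i.rep (i.rep)ᘁ ▷ A ≫ (λ_ A).hom with hv
    conv_lhs => rw [← Category.id_comp v, ← whiskerLeft_id, ← hπι i]
    simp only [whiskerLeft_sum, Preadditive.sum_comp, sandwich_sum_right,
      MonoidalCategory.whiskerLeft_comp, Category.assoc]
    refine Finset.sum_congr rfl fun j _ => Finset.sum_congr rfl fun s _ => ?_
    rw [← sandwich_comp_whiskerLeft θ hθ]
    simp only [leftMate_apply, Category.assoc]
    rfl
  have hr : ∀ j : SimpleClass C, sandwich θ
        ((ρ_ A).inv ≫ A ◁ ribbonCoev j.rep ≫ (α_ A _ _).inv)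
        ((α_ A _ _).hom ≫ A ◁ ε_ j.rep (j.rep)ᘁ ≫ (ρ_ A).hom) =
      ∑ i, ∑ t, sandwich θ (rightMate A j.rep (i.rep)ᘁ (ρ j i t))
        ((tensorRightHomEquiv (i.rep)ᘁ j.rep _ A).symm (κ j i t)) := fun j => by
    set v := (α_ A _ _).hom ≫ A ◁ ε_ j.rep (j.rep)ᘁ ≫ (ρ_ A).hom with hv
    conv_lhs => rw [← Category.id_comp v, ← id_whiskerRight, ← hρκ j]
    simp only [sum_whiskerRight, Preadditive.sum_comp, sandwich_sum_right,
      comp_whiskerRight, Category.assoc]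
    refine Finset.sum_congr rfl fun i _ => Finset.sum_congr rfl fun t _ => ?_
    rw [← sandwich_comp_whiskerRight θ]
    simp only [rightMate_apply, Category.assoc]
    rfl
  simp_rw [hl, hr, Finset.smul_sum (s := Finset.univ (α := SimpleClass C))]
  rw [Finset.sum_comm]
  refine Finset.sum_congr rfl fun j _ => Finset.sum_congr rfl fun i _ => ?_
  refine sum_sandwich_mates θ h1 (i.categoricalDim_rep k) (j.categoricalDim_rep k)
    (i.end_dual_eq_smul_id k) (j.end_eq_smul_id k) (fun g => ?_) (fun g => ?_)
  · conv_rhs => rw [← Category.comp_id g, ← hπι i, Preadditive.comp_sum]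
    rw [Finset.sum_eq_single j]
    · simp [Preadditive.comp_sum]
    · intro j' _ hj'
      simp only [Preadditive.comp_sum, ← Category.assoc]
      exact Finset.sum_eq_zero fun s _ => by
        rw [SimpleClass.hom_eq_zero hj'.symm (g ≫ π i j' s), zero_comp]
    · simp
  · conv_rhs => rw [← Category.id_comp g, ← hρκ j, Preadditive.sum_comp]
    rw [Finset.sum_eq_single i]
    · simp [Preadditive.sum_comp]
    · intro i' _ hi'
      simp only [Preadditive.sum_comp, Category.assoc]
      exact Finset.sum_eq_zero fun s _ => by
        rw [SimpleClass.dual_hom_eq_zero hi' (κ j i' s ≫ g), comp_zero]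
    · simp

end Fusion

/-! ### Calculus of intertwiners in the Drinfeld center. -/

namespace CategoryTheory.HalfBraiding

variable {C : Type u} [Category.{v} C] [MonoidalCategory C] {W X Y Z : C}

theorem intertwines_iff_β {b : HalfBraiding X} {b' : HalfBraiding Y} {f : X ⟶ Y} :
    Intertwines b b' f ↔ ∀ A, f ▷ A ≫ (b'.β A).hom = (b.β A).hom ≫ A ◁ f := by
  refine forall_congr' fun A => ?_
  change A ◁ f ≫ (b'.β A).inv = (b.β A).inv ≫ f ▷ A ↔ _
  rw [Iso.comp_inv_eq, Category.assoc, ← Iso.inv_comp_eq, eq_comm]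

theorem Intertwines.comp {b₁ : HalfBraiding X} {b₂ : HalfBraiding Y} {b₃ : HalfBraiding Z}
    {f : X ⟶ Y} {g : Y ⟶ Z} (hf : Intertwines b₁ b₂ f) (hg : Intertwines b₂ b₃ g) :
    Intertwines b₁ b₃ (f ≫ g) := fun A => by
  rw [MonoidalCategory.whiskerLeft_comp, Category.assoc, hg A, reassoc_of% hf A, comp_whiskerRight]

theorem Intertwines.inv {b : HalfBraiding X} {b' : HalfBraiding Y} {e : X ≅ Y}
    (h : Intertwines b b' e.hom) : Intertwines b' b e.inv := fun A => by
  rw [← cancel_epi (A ◁ e.hom), whiskerLeft_hom_inv_assoc, reassoc_of% h A,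
    hom_inv_whiskerRight, Category.comp_id]

theorem Intertwines.inv_comm {b : HalfBraiding X} {b' : HalfBraiding Y} {f : X ⟶ Y}
    (h : Intertwines b b' f) (A : C) : f ▷ A ≫ (b'.lam A).inv = (b.lam A).inv ≫ A ◁ f := by
  rw [Iso.comp_inv_eq, Category.assoc, h A, Iso.inv_hom_id_assoc]

/-- An object with a half-braiding, as an object of the Drinfeld center. -/
def toCenter (b : HalfBraiding X) : Center C := ⟨X, b⟩

/-- An intertwiner, as a morphism of the Drinfeld center. -/
def Intertwines.centerHom {b : HalfBraiding X} {b' : HalfBraiding Y} {f : X ⟶ Y}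
    (h : Intertwines b b' f) : b.toCenter ⟶ b'.toCenter := ⟨f, intertwines_iff_β.1 h⟩

theorem intertwines_of_center {P Q : Center C} (f : P ⟶ Q) : Intertwines P.2 Q.2 f.f :=
  intertwines_iff_β.2 f.comm

/-- The half-braiding on a tensor product. -/
def tensor (b : HalfBraiding X) (b' : HalfBraiding Y) : HalfBraiding (X ⊗ Y) :=
  (Center.tensorObj b.toCenter b'.toCenter).2

theorem tensor_lam_hom (b : HalfBraiding X) (b' : HalfBraiding Y) (A : C) :
    ((b.tensor b').lam A).hom = (α_ A X Y).inv ≫ (b.lam A).hom ▷ Y ≫ (α_ X A Y).hom ≫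
      X ◁ (b'.lam A).hom ≫ (α_ X Y A).inv := by
  change (α_ _ _ _ ≪≫ (whiskerLeftIso X (b'.β A)) ≪≫ (α_ _ _ _).symm ≪≫
            (whiskerRightIso (b.β A) Y) ≪≫ α_ _ _ _).inv = _
  simp [lam]

/-- The half-braiding on the unit object. -/
def unit : HalfBraiding (𝟙_ C) := (Center.tensorUnit : Center C).2

theorem Intertwines.whiskerLeft (b : HalfBraiding W) {b₁ : HalfBraiding X} {b₂ : HalfBraiding Y}
    {f : X ⟶ Y} (h : Intertwines b₁ b₂ f) : Intertwines (b.tensor b₁) (b.tensor b₂) (W ◁ f) :=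
  intertwines_of_center (Center.whiskerLeft b.toCenter h.centerHom)

theorem Intertwines.whiskerRight {b₁ : HalfBraiding X} {b₂ : HalfBraiding Y}
    {f : X ⟶ Y} (h : Intertwines b₁ b₂ f) (b : HalfBraiding W) :
    Intertwines (b₁.tensor b) (b₂.tensor b) (f ▷ W) :=
  intertwines_of_center (Center.whiskerRight h.centerHom b.toCenter)

theorem intertwines_associator (b₁ : HalfBraiding X) (b₂ : HalfBraiding Y) (b₃ : HalfBraiding Z) :
    Intertwines ((b₁.tensor b₂).tensor b₃) (b₁.tensor (b₂.tensor b₃)) (α_ X Y Z).hom :=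
  intertwines_of_center (Center.associator b₁.toCenter b₂.toCenter b₃.toCenter).hom

theorem intertwines_leftUnitor (b : HalfBraiding X) :
    Intertwines (unit.tensor b) b (λ_ X).hom :=
  intertwines_of_center (Center.leftUnitor b.toCenter).hom

variable [BraidedCategory C]

/-- The half-braiding given by the braiding. -/
def braided (B : C) : HalfBraiding B := (Center.ofBraidedObj B).2

theorem braided_lam_hom (B A : C) : ((braided B).lam A).hom = (β_ B A).inv := rfl

/-- The half-braiding given by the inverse of the braiding. -/
def reverseBraided (B : C) : HalfBraiding B where
  β A := (β_ A B).symm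

theorem reverseBraided_lam_hom (B A : C) : ((reverseBraided B).lam A).hom = (β_ A B).hom := rfl

theorem intertwines_coevaluation {D B : C} (c : 𝟙_ C ⟶ D ⊗ B) :
    Intertwines unit ((braided D).tensor (braided B)) c := fun A => by
  rw [tensor_lam_hom, braided_lam_hom, braided_lam_hom]
  change _ = (λ_ A ≪≫ (ρ_ A).symm).inv ≫ _
  have h := BraidedCategory.braiding_inv_naturality_right A c
  rw [BraidedCategory.braiding_tensor_left_inv, braiding_inv_tensorUnit_left] at h
  simpa using h

theorem intertwines_evaluation {D B : C} (e : D ⊗ B ⟶ 𝟙_ C) :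
    Intertwines ((braided D).tensor (braided B)) unit e := fun A => by
  rw [tensor_lam_hom, braided_lam_hom, braided_lam_hom]
  change _ ≫ (λ_ A ≪≫ (ρ_ A).symm).inv = _
  have h := BraidedCategory.braiding_inv_naturality_right A e
  rw [BraidedCategory.braiding_tensor_left_inv, braiding_inv_tensorUnit_left] at h
  simpa using h

/-- If conjugation at `B` intertwines, then so does the morphism obtained by encircling with
`B`. -/
theorem intertwines_sandwich {b : HalfBraiding X} {b' : HalfBraiding Y}
    (θ : ∀ B : C, B ⊗ X ⟶ B ⊗ Y) {D B : C} (c : 𝟙_ C ⟶ D ⊗ B) (e : D ⊗ B ⟶ 𝟙_ C)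
    (h : Intertwines ((braided B).tensor b) ((braided B).tensor b') (θ B)) :
    Intertwines b b' ((λ_ X).inv ≫ sandwich θ c e ≫ (λ_ Y).hom) := by
  refine (intertwines_leftUnitor b).inv.comp (Intertwines.comp ?_ (intertwines_leftUnitor b'))
  refine ((intertwines_coevaluation c).whiskerRight b).comp ?_
  refine (intertwines_associator _ _ _).comp ?_
  refine (h.whiskerLeft (braided D)).comp ?_
  exact (intertwines_associator _ _ _).inv.comp ((intertwines_evaluation e).whiskerRight b')

end CategoryTheory.HalfBraiding

namespace EllipticCenter

open HalfBraiding

variable {C : Type u} [Category.{v} C] [MonoidalCategory C] [BraidedCategory C]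

/-- This is the compatibility axiom of the elliptic center reread: the factor `c_{B,A}⁻¹` is the
braided half-braiding on `B`, and `c_{A,B}` is the reversed one. -/
theorem intertwines_lam₂ (P : EllipticCenter C) (B : C) :
    Intertwines ((braided B).tensor P.lam₁) (P.lam₁.tensor (reverseBraided B))
      (P.lam₂.lam B).hom := fun A => by
  rw [tensor_lam_hom, tensor_lam_hom, braided_lam_hom, reverseBraided_lam_hom]
  have h := P.comm A B =≫ (α_ P.X B A).inv
  simpa using h

/-- Conjugation by the second half-braidings preserves intertwiners of the first ones. -/
theorem intertwines_conj {P Q : EllipticCenter C} {f : P.X ⟶ Q.X}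
    (h : Intertwines P.lam₁ Q.lam₁ f) (B : C) :
    Intertwines ((braided B).tensor P.lam₁) ((braided B).tensor Q.lam₁)
      (conj P.lam₂ Q.lam₂ f B) :=
  (P.intertwines_lam₂ B).comp ((h.whiskerRight _).comp (Q.intertwines_lam₂ B).inv)

end EllipticCenter

/-! ### Averaging over one half-braiding. -/

namespace CategoryTheory.HalfBraiding

section Linear

variable {C : Type u} [Category.{v} C] [MonoidalCategory C] [Preadditive C] [MonoidalPreadditive C]
  {W X Y Z : C}

theorem conj_sum (b : HalfBraiding X) (b' : HalfBraiding Y) {T : Type*} (s : Finset T)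
    (f : T → (X ⟶ Y)) (A : C) : conj b b' (∑ t ∈ s, f t) A = ∑ t ∈ s, conj b b' (f t) A := by
  simp [conj, sum_whiskerRight, Preadditive.comp_sum, Preadditive.sum_comp]

theorem conj_smul {k : Type w} [Field k] [Linear k C] [MonoidalLinear k C] (b : HalfBraiding X)
    (b' : HalfBraiding Y) (c : k) (f : X ⟶ Y) (A : C) :
    conj b b' (c • f) A = c • conj b b' f A := by
  simp [conj]

end Linear

section Comp

variable {C : Type u} [Category.{v} C] [MonoidalCategory C] {W X Y Z : C}

theorem conj_comp {b₁ : HalfBraiding X} {b₂ : HalfBraiding Y} {b₃ : HalfBraiding Z} (f : X ⟶ Y)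
    (g : Y ⟶ Z) (A : C) : conj b₁ b₃ (f ≫ g) A = conj b₁ b₂ f A ≫ conj b₂ b₃ g A := by
  simp [conj]

/-- Encircling a morphism with an object. -/
def encircle (b : HalfBraiding X) (b' : HalfBraiding Y) {D B : C} (c : 𝟙_ C ⟶ D ⊗ B)
    (e : D ⊗ B ⟶ 𝟙_ C) (f : X ⟶ Y) : X ⟶ Y :=
  (λ_ X).inv ≫ sandwich (conj b b' f) c e ≫ (λ_ Y).hom

/-- An intertwiner is unchanged by conjugation, so it leaves the loop and only the scalar `c ≫ e`
remains. -/
theorem encircle_of_intertwines {b : HalfBraiding X} {b' : HalfBraiding Y} {D B : C}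
    (c : 𝟙_ C ⟶ D ⊗ B) (e : D ⊗ B ⟶ 𝟙_ C) {f : X ⟶ Y} (h : Intertwines b b' f) :
    encircle b b' c e f = (λ_ X).inv ≫ (c ≫ e) ▷ X ≫ (λ_ X).hom ≫ f := by
  rw [encircle, sandwich, intertwines_iff_conj.1 h]
  calc _ = 𝟙 _ ⊗≫ c ▷ X ⊗≫ ((D ⊗ B) ◁ f ≫ e ▷ Y) ⊗≫ 𝟙 _ := by monoidal
    _ = _ := by rw [whisker_exchange]; monoidal

theorem encircle_comp_left {b₁ : HalfBraiding W} {b : HalfBraiding X} (b' : HalfBraiding Y)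
    {D B : C} (c : 𝟙_ C ⟶ D ⊗ B) (e : D ⊗ B ⟶ 𝟙_ C) {g : W ⟶ X} (h : Intertwines b₁ b g)
    (f : X ⟶ Y) : encircle b₁ b' c e (g ≫ f) = g ≫ encircle b b' c e f := by
  rw [encircle, sandwich, conj_comp (b₂ := b), intertwines_iff_conj.1 h, encircle, sandwich]
  calc _ = 𝟙 _ ⊗≫ (c ▷ W ≫ (D ⊗ B) ◁ g) ⊗≫ D ◁ conj b b' f B ⊗≫ e ▷ Y ⊗≫ 𝟙 _ := by monoidal
    _ = _ := by rw [← whisker_exchange]; monoidal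

theorem encircle_comp_right (b : HalfBraiding X) {b' : HalfBraiding Y} {b₁ : HalfBraiding Z}
    {D B : C} (c : 𝟙_ C ⟶ D ⊗ B) (e : D ⊗ B ⟶ 𝟙_ C) (f : X ⟶ Y) {g : Y ⟶ Z}
    (h : Intertwines b' b₁ g) : encircle b b₁ c e (f ≫ g) = encircle b b' c e f ≫ g := by
  rw [encircle, sandwich, conj_comp (b₂ := b'), intertwines_iff_conj.1 h, encircle, sandwich]
  calc _ = 𝟙 _ ⊗≫ c ▷ X ⊗≫ D ◁ conj b b' f B ⊗≫ ((D ⊗ B) ◁ g ≫ e ▷ Z) ⊗≫ 𝟙 _ := by monoidal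
    _ = _ := by rw [whisker_exchange]; monoidal

theorem encircle_sum [Preadditive C] [MonoidalPreadditive C] (b : HalfBraiding X)
    (b' : HalfBraiding Y) {D B : C} (c : 𝟙_ C ⟶ D ⊗ B) (e : D ⊗ B ⟶ 𝟙_ C) {T : Type*}
    (s : Finset T) (f : T → (X ⟶ Y)) :
    encircle b b' c e (∑ t ∈ s, f t) = ∑ t ∈ s, encircle b b' c e (f t) := by
  simp [encircle, sandwich, conj_sum, whiskerLeft_sum, Preadditive.comp_sum, Preadditive.sum_comp]

/-- The first half of an encircled composite. -/
def encircleFst (b : HalfBraiding X) {D B : C} (c : 𝟙_ C ⟶ D ⊗ B) (g : X ⟶ Z) :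
    X ⟶ D ⊗ (Z ⊗ B) :=
  (λ_ X).inv ≫ c ▷ X ≫ (α_ D B X).hom ≫ D ◁ ((b.lam B).hom ≫ g ▷ B)

/-- The second half of an encircled composite. -/
def encircleSnd (b' : HalfBraiding Y) {D B : C} (e : D ⊗ B ⟶ 𝟙_ C) (h : Z ⟶ Y) :
    D ⊗ (Z ⊗ B) ⟶ Y :=
  D ◁ (h ▷ B ≫ (b'.lam B).inv) ≫ (α_ D B Y).inv ≫ e ▷ Y ≫ (λ_ Y).hom

/-- Cutting the loop at the middle object `Z` leaves two halves, each seeing only one of the two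
half-braidings. -/
theorem encircle_comp (b : HalfBraiding X) (b' : HalfBraiding Y) {D B : C} (c : 𝟙_ C ⟶ D ⊗ B)
    (e : D ⊗ B ⟶ 𝟙_ C) (g : X ⟶ Z) (h : Z ⟶ Y) :
    encircle b b' c e (g ≫ h) = encircleFst b c g ≫ encircleSnd b' e h := by
  simp [encircle, sandwich, conj, encircleFst, encircleSnd]

end Comp

section Average

variable (k : Type w) [Field k] [IsAlgClosed k] {C : Type u} [Category.{v} C] [Abelian C]
  [Linear k C] [MonoidalCategory C] [MonoidalPreadditive C] [MonoidalLinear k C]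
  [RigidCategory C] [IsFusionCategory k C] [BraidedCategory C] [RibbonCategory C]
  [Fintype (SimpleClass C)] {W X Y Z : C}

/-- The average of a morphism: its weighted mean over the encirclings by simple objects. -/
noncomputable def average (b : HalfBraiding X) (b' : HalfBraiding Y) (f : X ⟶ Y) : X ⟶ Y :=
  (∑ j : SimpleClass C, j.dim k ^ 2)⁻¹ •
    ∑ j : SimpleClass C, j.dim k • encircle b b' (ribbonCoev j.rep) (ε_ j.rep (j.rep)ᘁ) f

theorem intertwines_average (b : HalfBraiding X) (b' : HalfBraiding Y) (f : X ⟶ Y) :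
    Intertwines b b' (average k b b' f) := by
  rw [intertwines_iff_conj]
  intro A
  have h := sum_sandwich_eq k (conj b b' f) (conj_naturality b b' f) A
  simp only [← conj_sandwich, ← whiskerLeft_sandwich] at h
  simp only [average, conj_smul, conj_sum, MonoidalLinear.whiskerLeft_smul, whiskerLeft_sum]
  exact congrArg _ h

theorem sum_dim_sq_ne_zero (hdim : globalDim C ≠ 0) : ∑ j : SimpleClass C, j.dim k ^ 2 ≠ 0 := by
  intro h
  apply hdim
  rw [globalDim, finsum_eq_sum_of_fintype]
  have h1 : ∀ j : SimpleClass C, categoricalDim j.rep ^ 2 = (j.dim k ^ 2) • (1 : End (𝟙_ C)) :=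
    fun j => by
      rw [j.categoricalDim_rep k]
      change (j.dim k • (1 : End (𝟙_ C))) ^ 2 = _
      rw [smul_pow, one_pow]
  simp_rw [h1]
  rw [← Finset.sum_smul, h, zero_smul]

theorem average_of_intertwines (hdim : globalDim C ≠ 0) {b : HalfBraiding X} {b' : HalfBraiding Y}
    {f : X ⟶ Y} (h : Intertwines b b' f) : average k b b' f = f := by
  have h1 : ∀ j : SimpleClass C, encircle b b' (ribbonCoev j.rep) (ε_ j.rep (j.rep)ᘁ) f =
      j.dim k • f := fun j => by
    rw [encircle_of_intertwines _ _ h, ribbonCoev_evaluation, j.categoricalDim_rep k]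
    simp
  simp_rw [average, h1, smul_smul, ← pow_two]
  rw [← Finset.sum_smul, smul_smul, inv_mul_cancel₀ (sum_dim_sq_ne_zero k hdim), one_smul]

theorem average_comp_left {b₁ : HalfBraiding W} {b : HalfBraiding X} (b' : HalfBraiding Y)
    {g : W ⟶ X} (h : Intertwines b₁ b g) (f : X ⟶ Y) :
    average k b₁ b' (g ≫ f) = g ≫ average k b b' f := by
  simp [average, encircle_comp_left b' _ _ h, Preadditive.comp_sum]

theorem average_comp_right (b : HalfBraiding X) {b' : HalfBraiding Y} {b₁ : HalfBraiding Z}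
    (f : X ⟶ Y) {g : Y ⟶ Z} (h : Intertwines b' b₁ g) :
    average k b b₁ (f ≫ g) = average k b b' f ≫ g := by
  simp [average, encircle_comp_right b _ _ f h, Preadditive.sum_comp]

theorem average_sum (b : HalfBraiding X) (b' : HalfBraiding Y) {T : Type*} (s : Finset T)
    (f : T → (X ⟶ Y)) : average k b b' (∑ t ∈ s, f t) = ∑ t ∈ s, average k b b' (f t) := by
  simp only [average, encircle_sum, Finset.smul_sum]
  rw [Finset.sum_comm]

/-- The average of a composite factors through an object that only depends on the object in the
middle. -/
theorem exists_average_comp (Z : C) : ∃ (M : C)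
    (L : ∀ {X : C}, HalfBraiding X → (X ⟶ Z) → (X ⟶ M))
    (R : ∀ {Y : C}, HalfBraiding Y → (Z ⟶ Y) → (M ⟶ Y)),
    ∀ {X Y : C} (b : HalfBraiding X) (b' : HalfBraiding Y) (g : X ⟶ Z) (h : Z ⟶ Y),
      average k b b' (g ≫ h) = L b g ≫ R b' h := by
  have : HasFiniteBiproducts C := HasFiniteBiproducts.of_hasFiniteProducts
  let e := (Fintype.equivFin (SimpleClass C)).symm
  -- All loops cut at `Z` are collected into one biproduct; the weights and the normalization are
  -- put into `R`.
  refine ⟨⨁ fun s => ((e s).rep)ᘁ ⊗ (Z ⊗ (e s).rep),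
    fun b g => biproduct.lift fun s => encircleFst b (ribbonCoev (e s).rep) g,
    fun b' h => (∑ j : SimpleClass C, j.dim k ^ 2)⁻¹ • biproduct.desc fun s =>
      (e s).dim k • encircleSnd b' (ε_ (e s).rep ((e s).rep)ᘁ) h, fun b b' g h => ?_⟩
  rw [Linear.comp_smul, biproduct.lift_desc, average]
  simp_rw [encircle_comp, Linear.comp_smul]
  rw [e.sum_comp fun j => j.dim k • encircleFst b (ribbonCoev j.rep) g ≫
    encircleSnd b' (ε_ j.rep (j.rep)ᘁ) h]

end Average

end CategoryTheory.HalfBraiding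

/-! ### Averaging over both half-braidings. -/

namespace EllipticCenter

open HalfBraiding

section Average

variable (k : Type w) [Field k] [IsAlgClosed k] {C : Type u} [Category.{v} C] [Abelian C]
  [Linear k C] [MonoidalCategory C] [MonoidalPreadditive C] [MonoidalLinear k C]
  [RigidCategory C] [IsFusionCategory k C] [BraidedCategory C] [RibbonCategory C]
  [Fintype (SimpleClass C)] {P Q R : EllipticCenter C}

/-- Every constituent of a `λ²`-loop, namely coevaluation, conjugation by `λ²` and evaluation,
intertwines the first half-braidings, the loop strands carrying the braiding. -/
theorem intertwines_average_lam₂ {f : P.X ⟶ Q.X} (h : Intertwines P.lam₁ Q.lam₁ f) :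
    Intertwines P.lam₁ Q.lam₁ (average k P.lam₂ Q.lam₂ f) := by
  have h1 : ∀ j : SimpleClass C, Intertwines P.lam₁ Q.lam₁
      (encircle P.lam₂ Q.lam₂ (ribbonCoev j.rep) (ε_ j.rep (j.rep)ᘁ) f) := fun j =>
    intertwines_sandwich _ _ _ (intertwines_conj h j.rep)
  simp only [intertwines_iff_conj] at h1 ⊢
  intro A
  simp only [average, conj_smul, conj_sum, MonoidalLinear.whiskerLeft_smul, whiskerLeft_sum, h1]

/-- The average of a morphism of `C` over both half-braidings, as a morphism of the elliptic
center. -/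
noncomputable def average (f : P.X ⟶ Q.X) : P ⟶ Q where
  f := HalfBraiding.average k P.lam₂ Q.lam₂ (HalfBraiding.average k P.lam₁ Q.lam₁ f)
  comm₁ := intertwines_average_lam₂ k (intertwines_average k _ _ _)
  comm₂ := intertwines_average k _ _ _

theorem average_f (f : P.X ⟶ Q.X) : (average k f : P ⟶ Q).f =
  HalfBraiding.average k P.lam₂ Q.lam₂ (HalfBraiding.average k P.lam₁ Q.lam₁ f) := rfl

theorem average_hom (hdim : globalDim C ≠ 0) (f : P ⟶ Q) : average k f.f = f := by
  apply hom_ext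
  rw [average_f, average_of_intertwines k hdim f.comm₁, average_of_intertwines k hdim f.comm₂]

theorem average_comp_left (g : P ⟶ Q) (f : Q.X ⟶ R.X) :
    (average k (g.f ≫ f) : P ⟶ R) = g ≫ average k f := by
  apply hom_ext
  rw [comp_f, average_f, average_f, HalfBraiding.average_comp_left k _ g.comm₁,
    HalfBraiding.average_comp_left k _ g.comm₂]

theorem average_comp_right (f : P.X ⟶ Q.X) (g : Q ⟶ R) :
    (average k (f ≫ g.f) : P ⟶ R) = average k f ≫ g := by
  apply hom_ext
  rw [comp_f, average_f, average_f, HalfBraiding.average_comp_right k _ _ g.comm₁,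
    HalfBraiding.average_comp_right k _ _ g.comm₂]

theorem average_sum {T : Type*} (s : Finset T) (f : T → (P.X ⟶ Q.X)) :
    (average k (∑ t ∈ s, f t) : P ⟶ Q).f = ∑ t ∈ s, (average k (f t) : P ⟶ Q).f := by
  simp only [average_f, HalfBraiding.average_sum]

/-- The one-step factorization is applied to `Z` for `λ¹` and then to the resulting `M₁` for `λ²`.
-/
theorem exists_average_comp (Z : C) : ∃ (M : C)
    (L : ∀ P : EllipticCenter C, (P.X ⟶ Z) → (P.X ⟶ M))
    (R : ∀ Q : EllipticCenter C, (Z ⟶ Q.X) → (M ⟶ Q.X)),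
    ∀ {P Q : EllipticCenter C} (g : P.X ⟶ Z) (h : Z ⟶ Q.X),
      (average k (g ≫ h) : P ⟶ Q).f = L P g ≫ R Q h := by
  obtain ⟨M₁, L₁, R₁, h₁⟩ := HalfBraiding.exists_average_comp k Z
  obtain ⟨M₂, L₂, R₂, h₂⟩ := HalfBraiding.exists_average_comp k M₁
  exact ⟨M₂, fun P g => L₂ P.lam₂ (L₁ P.lam₁ g), fun Q h => R₂ Q.lam₂ (R₁ Q.lam₁ h),
    fun g h => by rw [average_f, h₁, h₂]⟩

end Average

/-- With `g` a quasi-inverse of `f` in `C`, bilinearity over the center gives `f ≫ average g ≫ f =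
average (f ≫ g ≫ f) = f`. -/
theorem isRegularMorphism (k : Type w) [Field k] [IsAlgClosed k] {C : Type u} [Category.{v} C]
    [Abelian C] [Linear k C] [MonoidalCategory C] [MonoidalPreadditive C] [MonoidalLinear k C]
    [RigidCategory C] [IsFusionCategory k C] [BraidedCategory C] [RibbonCategory C]
    (hdim : globalDim C ≠ 0) {P Q : EllipticCenter C} (f : P ⟶ Q) : IsRegularMorphism f := by
  have := IsFusionCategory.finite_simples k (C := C)
  have := Fintype.ofFinite (SimpleClass C)
  obtain ⟨g, hg⟩ := isRegularMorphism_of_isSemisimpleCategory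
    (IsFusionCategory.semisimple k (C := C)) f.f
  refine ⟨average k g, ?_⟩
  rw [← average_comp_right, ← average_comp_left, hg, average_hom k hdim]

end EllipticCenter

/-! ### Lifting retracts and biproducts to the elliptic center. -/

namespace CategoryTheory.HalfBraiding

variable {C : Type u} [Category.{v} C] [MonoidalCategory C] [Preadditive C] [MonoidalPreadditive C]
  {X : C} {T : Type*} [Fintype T] {Y : T → C} {i : ∀ t, X ⟶ Y t} {p : ∀ t, Y t ⟶ X}

theorem eq_of_whiskerLeft_comp_eq (hip : ∑ t, i t ≫ p t = 𝟙 X) {A Z : C} {f g : A ⊗ X ⟶ Z}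
    (h : ∀ t, A ◁ p t ≫ f = A ◁ p t ≫ g) : f = g := by
  rw [← Category.id_comp f, ← Category.id_comp g, ← whiskerLeft_id, ← hip]
  simp [whiskerLeft_sum, Preadditive.sum_comp, h]

theorem eq_of_whiskerRight_comp_eq (hip : ∑ t, i t ≫ p t = 𝟙 X) {A Z : C} {f g : X ⊗ A ⟶ Z}
    (h : ∀ t, p t ▷ A ≫ f = p t ▷ A ≫ g) : f = g := by
  rw [← Category.id_comp f, ← Category.id_comp g, ← id_whiskerRight, ← hip]
  simp [sum_whiskerRight, Preadditive.sum_comp, h]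

variable (b : ∀ t, HalfBraiding (Y t))

/-- The half-braiding slides past the intertwiner `p s ≫ i t`, after which `∑ t, i t ≫ p t = 𝟙 X`
collapses the sum. As the `A ◁ p s` are jointly epimorphic, all axioms for the induced half-braiding
reduce to those of the `b s`. -/
theorem whiskerLeft_comp_sum_lam (hip : ∑ t, i t ≫ p t = 𝟙 X)
    (hpi : ∀ s t, Intertwines (b s) (b t) (p s ≫ i t)) (A : C) (s : T) :
    A ◁ p s ≫ ∑ t, A ◁ i t ≫ ((b t).lam A).hom ≫ p t ▷ A = ((b s).lam A).hom ≫ p s ▷ A := by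
  have h : ∀ t, A ◁ p s ≫ A ◁ i t ≫ ((b t).lam A).hom ≫ p t ▷ A =
      ((b s).lam A).hom ≫ p s ▷ A ≫ (i t ≫ p t) ▷ A := fun t => by
    rw [← MonoidalCategory.whiskerLeft_comp_assoc, reassoc_of% hpi s t A]
    simp
  simp only [Preadditive.comp_sum, h]
  rw [← Preadditive.comp_sum, ← Preadditive.comp_sum, ← sum_whiskerRight, hip]
  simp

theorem whiskerRight_comp_sum_lam_inv (hip : ∑ t, i t ≫ p t = 𝟙 X)
    (hpi : ∀ s t, Intertwines (b s) (b t) (p s ≫ i t)) (A : C) (s : T) :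
    p s ▷ A ≫ ∑ t, i t ▷ A ≫ ((b t).lam A).inv ≫ A ◁ p t = ((b s).lam A).inv ≫ A ◁ p s := by
  have h : ∀ t, p s ▷ A ≫ i t ▷ A ≫ ((b t).lam A).inv ≫ A ◁ p t =
      ((b s).lam A).inv ≫ A ◁ p s ≫ A ◁ (i t ≫ p t) := fun t => by
    rw [← comp_whiskerRight_assoc, reassoc_of% (hpi s t).inv_comm A]
    simp
  simp only [Preadditive.comp_sum, h]
  rw [← Preadditive.comp_sum, ← Preadditive.comp_sum, ← whiskerLeft_sum, hip]
  simp

/-- The half-braiding induced on a retract of a direct sum. -/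
def retract (hip : ∑ t, i t ≫ p t = 𝟙 X) (hpi : ∀ s t, Intertwines (b s) (b t) (p s ≫ i t)) :
    HalfBraiding X :=
  ofLam (fun A =>
    { hom := ∑ t, A ◁ i t ≫ ((b t).lam A).hom ≫ p t ▷ A
      inv := ∑ t, i t ▷ A ≫ ((b t).lam A).inv ≫ A ◁ p t
      hom_inv_id := eq_of_whiskerLeft_comp_eq hip fun s => by
        rw [reassoc_of% whiskerLeft_comp_sum_lam b hip hpi A s,
          whiskerRight_comp_sum_lam_inv b hip hpi A s]
        simp
      inv_hom_id := eq_of_whiskerRight_comp_eq hip fun s => by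
        rw [reassoc_of% whiskerRight_comp_sum_lam_inv b hip hpi A s,
          whiskerLeft_comp_sum_lam b hip hpi A s]
        simp })
    (fun {A B} f => eq_of_whiskerLeft_comp_eq hip fun s => by
      dsimp only
      rw [reassoc_of% whiskerLeft_comp_sum_lam b hip hpi A s, whisker_exchange_assoc,
        whiskerLeft_comp_sum_lam b hip hpi B s, reassoc_of% lam_naturality, whisker_exchange])
    (fun A B => eq_of_whiskerLeft_comp_eq hip fun s => by
      dsimp only
      rw [whiskerLeft_comp_sum_lam b hip hpi (A ⊗ B) s, lam_tensor,
        associator_naturality_right_assoc,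
        ← MonoidalCategory.whiskerLeft_comp_assoc A (B ◁ p s),
        whiskerLeft_comp_sum_lam b hip hpi B s]
      simp only [MonoidalCategory.whiskerLeft_comp, Category.assoc]
      rw [associator_inv_naturality_middle_assoc, ← comp_whiskerRight_assoc (A ◁ p s),
        whiskerLeft_comp_sum_lam b hip hpi A s]
      simp)

theorem intertwines_retract_proj (hip : ∑ t, i t ≫ p t = 𝟙 X)
    (hpi : ∀ s t, Intertwines (b s) (b t) (p s ≫ i t)) (s : T) :
    Intertwines (b s) (retract b hip hpi) (p s) := fun A =>
  whiskerLeft_comp_sum_lam b hip hpi A s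

theorem intertwines_retract_incl (hip : ∑ t, i t ≫ p t = 𝟙 X)
    (hpi : ∀ s t, Intertwines (b s) (b t) (p s ≫ i t)) (t : T) :
    Intertwines (retract b hip hpi) (b t) (i t) := fun A => by
  refine eq_of_whiskerLeft_comp_eq hip fun s => ?_
  rw [reassoc_of% intertwines_retract_proj b hip hpi s A, ← comp_whiskerRight, ← hpi s t A,
    MonoidalCategory.whiskerLeft_comp_assoc]

end CategoryTheory.HalfBraiding

namespace EllipticCenter

open HalfBraiding

section Retract

variable {C : Type u} [Category.{v} C] [MonoidalCategory C] [BraidedCategory C]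

theorem whiskerLeft_comm {P : EllipticCenter C} {X : C} {b₁ b₂ : HalfBraiding X} {p : P.X ⟶ X}
    (h₁ : Intertwines P.lam₁ b₁ p) (h₂ : Intertwines P.lam₂ b₂ p) (A B : C) :
    A ◁ B ◁ p ≫ A ◁ (b₂.lam B).hom ≫ (α_ A X B).inv ≫ (b₁.lam A).hom ▷ B ≫ (α_ X A B).hom ≫
        X ◁ (β_ A B).hom =
      A ◁ B ◁ p ≫ (α_ A B X).inv ≫ (β_ B A).inv ▷ X ≫ (α_ B A X).hom ≫ B ◁ (b₁.lam A).hom ≫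
        (α_ B X A).inv ≫ (b₂.lam B).hom ▷ A ≫ (α_ X B A).hom := by
  calc _ = (A ◁ (P.lam₂.lam B).hom ≫ (α_ A P.X B).inv ≫ (P.lam₁.lam A).hom ▷ B ≫
          (α_ P.X A B).hom ≫ P.X ◁ (β_ A B).hom) ≫ p ▷ (B ⊗ A) := by
        rw [← MonoidalCategory.whiskerLeft_comp_assoc, h₂ B]
        simp only [MonoidalCategory.whiskerLeft_comp, Category.assoc]
        rw [associator_inv_naturality_middle_assoc, ← comp_whiskerRight_assoc (A ◁ p), h₁ A]
        simp only [comp_whiskerRight, Category.assoc]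
        rw [associator_naturality_left_assoc, ← whisker_exchange]
    _ = _ := by
        rw [P.comm, associator_inv_naturality_right_assoc, whisker_exchange_assoc,
          associator_naturality_right_assoc, ← MonoidalCategory.whiskerLeft_comp_assoc B (A ◁ p),
          h₁ A]
        simp only [MonoidalCategory.whiskerLeft_comp, Category.assoc]
        rw [associator_inv_naturality_middle_assoc B p A, ← comp_whiskerRight_assoc (B ◁ p), h₂ B]
        simp

variable [Preadditive C] [MonoidalPreadditive C] {X : C} {T : Type*} [Fintype T]
  {P : T → EllipticCenter C} {i : ∀ t, X ⟶ (P t).X}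
  {p : ∀ t, (P t).X ⟶ X}

/-- The structure of an object of the elliptic center induced on a retract of a direct sum. -/
def retract (hip : ∑ t, i t ≫ p t = 𝟙 X)
    (h₁ : ∀ s t, Intertwines (P s).lam₁ (P t).lam₁ (p s ≫ i t))
    (h₂ : ∀ s t, Intertwines (P s).lam₂ (P t).lam₂ (p s ≫ i t)) : EllipticCenter C where
  X := X
  lam₁ := HalfBraiding.retract (fun t => (P t).lam₁) hip h₁
  lam₂ := HalfBraiding.retract (fun t => (P t).lam₂) hip h₂
  comm A B := by
    have hip' : ∑ t, B ◁ i t ≫ B ◁ p t = 𝟙 (B ⊗ X) := by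
      simp_rw [← MonoidalCategory.whiskerLeft_comp, ← whiskerLeft_sum, hip, whiskerLeft_id]
    exact eq_of_whiskerLeft_comp_eq hip' fun s => whiskerLeft_comm
      (intertwines_retract_proj (fun t => (P t).lam₁) hip h₁ s)
      (intertwines_retract_proj (fun t => (P t).lam₂) hip h₂ s) A B

theorem exists_retract (hip : ∑ t, i t ≫ p t = 𝟙 X) (e : ∀ s t, P s ⟶ P t)
    (he : ∀ s t, (e s t).f = p s ≫ i t) :
    ∃ (R : EllipticCenter C) (I : ∀ t, R ⟶ P t) (J : ∀ t, P t ⟶ R),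
      ∑ t, I t ≫ J t = 𝟙 R ∧ ∀ s t, J s ≫ I t = e s t := by
  have h₁ : ∀ s t, Intertwines (P s).lam₁ (P t).lam₁ (p s ≫ i t) :=
    fun s t => he s t ▸ (e s t).comm₁
  have h₂ : ∀ s t, Intertwines (P s).lam₂ (P t).lam₂ (p s ≫ i t) :=
    fun s t => he s t ▸ (e s t).comm₂
  let R := retract hip h₁ h₂
  let I : ∀ t, R ⟶ P t := fun t => ⟨i t, intertwines_retract_incl _ hip h₁ t,
    intertwines_retract_incl _ hip h₂ t⟩
  let J : ∀ t, P t ⟶ R := fun t => ⟨p t, intertwines_retract_proj _ hip h₁ t,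
    intertwines_retract_proj _ hip h₂ t⟩
  let φ : (R ⟶ R) →+ (R.X ⟶ R.X) := ⟨⟨fun f => f.f, rfl⟩, fun _ _ => rfl⟩
  refine ⟨R, I, J, hom_ext ?_, fun s t => hom_ext (he s t).symm⟩
  change φ (∑ t, I t ≫ J t) = _
  rw [map_sum]
  exact hip

end Retract

section Abelian

variable {C : Type u} [Category.{v} C] [Abelian C] [MonoidalCategory C] [MonoidalPreadditive C]
  [BraidedCategory C]

instance : IsIdempotentComplete (EllipticCenter C) where
  idempotents_split P e he := by
    obtain ⟨X, i, p, hip, hpi⟩ := IsIdempotentComplete.idempotents_split P.X e.f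
      (congrArg Hom.f he)
    -- An idempotent is the case of a single summand; biproducts below are the case where the matrix
    -- `p s ≫ i t` is the identity.
    obtain ⟨R, I, J, hIJ, hJI⟩ := exists_retract (T := Unit) (P := fun _ => P) (i := fun _ => i)
      (p := fun _ => p) (by simpa using hip) (fun _ _ => e) (fun _ _ => hpi.symm)
    exact ⟨R, I (), J (), by simpa using hIJ, hJI () ()⟩

instance : HasFiniteBiproducts (EllipticCenter C) where
  out n := ⟨fun P => by
    have : HasFiniteBiproducts C := HasFiniteBiproducts.of_hasFiniteProducts
    classical
    obtain ⟨R, I, J, hIJ, hJI⟩ := exists_retract (P := P)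
      (i := fun t => biproduct.π (fun t => (P t).X) t)
      (p := fun t => biproduct.ι (fun t => (P t).X) t) (by simp)
      (fun s t => if h : s = t then eqToHom (by rw [h]) else 0) (fun s t => by
        rw [biproduct.ι_π]
        split_ifs with h
        · subst h; rfl
        · rfl)
    exact HasBiproduct.mk ⟨⟨R, I, J, fun s t => by rw [hJI]; congr⟩, isBilimitOfTotal _ hIJ⟩⟩

end Abelian

end EllipticCenter

/-! ### Length bound and finiteness of the simple objects. -/

namespace EllipticCenter

section Faithful

variable {C : Type u} [Category.{v} C] [Preadditive C] [MonoidalCategory C]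
  [MonoidalPreadditive C] [BraidedCategory C]

theorem isZero_of_isZero_X {P : EllipticCenter C} (h : IsZero P.X) : IsZero P :=
  (IsZero.iff_id_eq_zero P).2 (hom_ext (h.eq_of_src _ _))

/-- Endomorphisms of the summand `Q` embed in those of `P` as a corner; the projection `q ≫ j` onto
the nonzero complement lies outside it. -/
theorem finrank_end_lt (k : Type w) [Field k] [Linear k C] {P Q R : EllipticCenter C}
    [FiniteDimensional k (P.X ⟶ P.X)] (i : Q ⟶ P) (p : P ⟶ Q) (j : R ⟶ P) (q : P ⟶ R)
    (hip : i ≫ p = 𝟙 Q) (hjq : j ≫ q = 𝟙 R) (ht : p ≫ i + q ≫ j = 𝟙 P) (hR : ¬ IsZero R) :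
    Module.finrank k (Q.X ⟶ Q.X) < Module.finrank k (P.X ⟶ P.X) := by
  have hip' : i.f ≫ p.f = 𝟙 _ := congrArg Hom.f hip
  have hjq' : j.f ≫ q.f = 𝟙 _ := congrArg Hom.f hjq
  have hjp : j.f ≫ p.f = 0 := by
    have h := congrArg Hom.f (j ≫= ht =≫ p)
    simpa [hip', reassoc_of% hjq'] using h
  let φ : (Q.X ⟶ Q.X) →ₗ[k] (P.X ⟶ P.X) :=
    (Linear.leftComp k P.X p.f).comp (Linear.rightComp k Q.X i.f)
  have hφ : ∀ f, φ f = p.f ≫ f ≫ i.f := fun f => rfl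
  have hinj : Function.Injective φ := fun f g h => by
    have h' := i.f ≫= h =≫ p.f
    simpa [hφ, hip', reassoc_of% hip'] using h'
  rw [← LinearMap.finrank_range_of_inj hinj]
  apply Submodule.finrank_lt
  intro htop
  obtain ⟨f, hf⟩ : q.f ≫ j.f ∈ LinearMap.range φ := htop ▸ Submodule.mem_top
  have h' := j.f ≫= hf =≫ q.f
  rw [hφ] at h'
  simp only [Category.assoc, reassoc_of% hjp, zero_comp, hjq', Category.comp_id] at h'
  exact hR (isZero_of_isZero_X ((IsZero.iff_id_eq_zero _).2 h'.symm))

end Faithful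

theorem finite_simpleClass (k : Type w) [Field k] [IsAlgClosed k] (C : Type u) [Category.{v} C]
    [Abelian C] [Linear k C] [MonoidalCategory C] [MonoidalPreadditive C] [MonoidalLinear k C]
    [RigidCategory C] [IsFusionCategory k C] [BraidedCategory C] [RibbonCategory C]
    (hdim : globalDim C ≠ 0) : Finite (SimpleClass (EllipticCenter C)) := by
  have := IsFusionCategory.finite_simples k (C := C)
  have := Fintype.ofFinite (SimpleClass C)
  have : HasKernels (EllipticCenter C) := ⟨fun f => (isRegularMorphism k hdim f).hasKernel⟩
  have h : ∀ q : SimpleClass (EllipticCenter C), ∃ (j : SimpleClass C) (g : q.rep.X ⟶ j.rep)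
      (h : j.rep ⟶ q.rep.X), (average k (g ≫ h) : q.rep ⟶ q.rep).f ≠ 0 := by
    intro q
    by_contra! hcon
    -- If all these averages vanished, so would the average of the resolved identity, which is the
    -- identity of a simple object.
    obtain ⟨n, π, ι, ht⟩ :=
      (IsFusionCategory.semisimple k (C := C)).exists_resolution q.rep.X
    have h0 : (average k (∑ j, ∑ s, π j s ≫ ι j s) : q.rep ⟶ q.rep).f = 0 := by
      simp [average_sum, hcon]
    rw [ht] at h0
    have h1 : average k (𝟙 q.rep.X) = 𝟙 q.rep := average_hom k hdim (𝟙 q.rep)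
    have := q.simple_rep
    exact id_nonzero q.rep (hom_ext (by rw [← h1, h0]; rfl))
  choose J g h hgh using h
  rw [← Set.finite_univ_iff, ← Set.preimage_univ (f := J)]
  refine Set.finite_univ.preimage' fun j _ => Set.finite_coe_iff.1 ?_
  obtain ⟨M, L, R, hLR⟩ := exists_average_comp k j.rep
  have := IsFusionCategory.finiteDimensional_hom (k := k) M M
  let g' : ∀ q : J ⁻¹' {j}, q.1.rep.X ⟶ j.rep := fun q => g q.1 ≫ eqToHom (by rw [q.2])
  let h' : ∀ q : J ⁻¹' {j}, j.rep ⟶ q.1.rep.X := fun q => eqToHom (by rw [q.2]) ≫ h q.1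
  have hne : ∀ q : J ⁻¹' {j}, IsIso (L _ (g' q) ≫ R _ (h' q)) := fun q => by
    rw [← hLR]
    have := q.1.simple_rep
    have h0 : (average k (g' q ≫ h' q) : q.1.rep ⟶ q.1.rep) ≠ 0 := fun h0 => hgh q.1 (by
      have h1 : g' q ≫ h' q = g q.1 ≫ h q.1 := by simp [g', h']
      rw [← h1, h0]; rfl)
    have := isIso_of_hom_simple h0
    exact ⟨(inv (average k (g' q ≫ h' q) : q.1.rep ⟶ q.1.rep)).f,
      by rw [← comp_f, IsIso.hom_inv_id, id_f], by rw [← comp_f, IsIso.inv_hom_id, id_f]⟩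
  have hzero : ∀ q r : J ⁻¹' {j}, q ≠ r → L _ (g' q) ≫ R _ (h' r) = 0 := fun q r hqr => by
    rw [← hLR, SimpleClass.hom_eq_zero (fun e => hqr (Subtype.ext e)) (average k _)]
    rfl
  -- Multiplying a relation by `L` of `q` on the left and `R` of `q` on the right kills all other
  -- terms by Schur and leaves the coefficient of `q` times the square of an isomorphism.
  have hli : LinearIndependent k fun q : J ⁻¹' {j} => R _ (h' q) ≫ L _ (g' q) := by
    rw [linearIndependent_iff']
    intro s c hc q hq
    have h1 := L _ (g' q) ≫= hc =≫ R _ (h' q)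
    simp only [Preadditive.comp_sum, Preadditive.sum_comp, Linear.comp_smul, Linear.smul_comp,
      Category.assoc, zero_comp, comp_zero] at h1
    rw [Finset.sum_eq_single_of_mem q hq fun r _ hr => by
      rw [hzero r q hr]; simp] at h1
    by_contra hcq
    have h2 := (smul_eq_zero.1 h1).resolve_left hcq
    have := hne q
    have h3 : 𝟙 q.1.rep.X = 0 := by
      rw [← cancel_epi (L _ (g' q) ≫ R _ (h' q)), ← cancel_epi (L _ (g' q) ≫ R _ (h' q))]
      simpa using h2
    have := q.1.simple_rep
    exact id_nonzero q.1.rep (hom_ext h3)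
  exact hli.finite

end EllipticCenter

theorem mainTheorem6 (k : Type w) [Field k] [IsAlgClosed k] [CharZero k]
    (C : Type u) [Category.{v} C] [Abelian C] [Linear k C]
    [MonoidalCategory C] [MonoidalPreadditive C] [MonoidalLinear k C]
    [RigidCategory C] [IsFusionCategory k C]
    [BraidedCategory C] [RibbonCategory C] (hdim : globalDim C ≠ 0) :
    (∃ A : Abelian (EllipticCenter C), A.toPreadditive = EllipticCenter.instPreadditive) ∧
      IsSemisimpleCategory (EllipticCenter C) ∧
      Finite (SimpleClass (EllipticCenter C)) := by
  refine ⟨⟨Abelian.ofRegular (EllipticCenter C) fun f => EllipticCenter.isRegularMorphism k hdim f,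
    rfl⟩, ?_, EllipticCenter.finite_simpleClass k C hdim⟩
  have hfd := IsFusionCategory.finiteDimensional_hom (k := k) (C := C)
  exact isSemisimpleCategory_of_regular (fun f => EllipticCenter.isRegularMorphism k hdim f)
    (fun P => Module.finrank k (P.X ⟶ P.X))
    fun i p j q h₁ h₂ h₃ h₄ => EllipticCenter.finrank_end_lt k i p j q h₁ h₂ h₃ h₄
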